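/- Let $(M,\phi,\xi,\eta,g_M)$ be a Sasakian manifold, i.e. a smooth Riemannian manifold with a $(1,1)$-tensor field $\phi$, a vector field $\xi$ and a $1$-form $\eta$ such that $\phi^2=-I+\eta\otimes\xi$, $\phi\xi=0$, $\eta\circ\phi=0$, $\eta(\xi)=1$, $g_M(\phi X,\phi Y)=g_M(X,Y)-\eta(X)\eta(Y)$, $\eta(X)=g_M(X,\xi)$, which is a contact metric structure, $d\eta(X,Y)=g_M(X,\phi Y)$, and is normal, $N_\phi+2\,d\eta\otimes\xi=0$; here $2\,d\eta(X,Y)=X\eta(Y)-Y\eta(X)-\eta([X,Y])$ and $N_\phi(X,Y)=\phi^2[X,Y]+[\phi X,\phi Y]-\phi[\phi X,Y]-\phi[X,\phi Y]$. Let $(N,g_N)$ be a Riemannian manifold and let $F:M\to N$ be an anti-invariant Riemannian submersion: a smooth surjective map of maximal rank whose differential $F_*$ preserves the lengths of vectors in $(\ker F_*)^\perp$, and such that $\phi(\ker F_*)\subseteq(\ker F_*)^\perp$. Assume that $\xi$ is horizontal, i.e. $\xi\in\Gamma((\ker F_*)^\perp)$. Let $\nabla$ be the Levi-Civita connection of $g_M$,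 let $\mathcal V$ and $\mathcal H$ be the orthogonal projections onto $\ker F_*$ and $(\ker F_*)^\perp$, and let $\mathcal A_EG=\mathcal V\nabla_{\mathcal HE}\mathcal HG+\mathcal H\nabla_{\mathcal HE}\mathcal VG$ for vector fields $E,G$ on $M$. Let $(\nabla F_*)(E,G)=\nabla^F_E(F_*G)-F_*(\nabla_EG)$ be the second fundamental form of $F$, where $\nabla^F$ is the pullback to $F^{-1}TN$ of the Levi-Civita connection of $g_N$. Let $\mu$ be the orthogonal complement of $\phi(\ker F_*)$ in $(\ker F_*)^\perp$, and for horizontal $X$ let $CX$ be the component of $\phi X$ in $\mu$, so that $\phi X=BX+CX$ with $BX\in\ker F_*$ and $CX\in\mu$. Then the following assertions are equivalent. (i) The distribution $(\ker F_*)^\perp$ is integrable. (ii) For all $X,Y\in\Gamma((\ker F_*)^\perp)$ and $V\in\Gamma(\ker F_*)$, $$\begin{aligned}g_N((\nabla F_*)(Y,\mathcal A_X\xi),F_*\phi V)={}&g_N((\nabla F_*)(X,\mathcal A_Y\xi),F_*\phi V)+g_M(CX,\phi\mathcal A_YV)-g_M(CY,\phi\mathcal A_XV)\\&+g_M(\mathcal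 A_X\xi,V)\,\eta(Y)-g_M(\mathcal A_Y\xi,V)\,\eta(X).\end{aligned}$$ (iii) For all $X,Y\in\Gamma((\ker F_*)^\perp)$ and $V\in\Gamma(\ker F_*)$, $$\begin{aligned}g_M(\mathcal A_X\mathcal A_Y\xi-\mathcal A_Y\mathcal A_X\xi,\phi V)={}&g_M(CX,\phi\mathcal A_YV)-g_M(CY,\phi\mathcal A_XV)\\&+g_M(\mathcal A_X\xi,V)\,\eta(Y)-g_M(\mathcal A_Y\xi,V)\,\eta(X).\end{aligned}$$ -/

import Mathlib

open Bundle
open scoped Manifold ContDiff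

noncomputable section

/-! ### Vector fields, distributions, directional derivatives -/

section Basic

variable (E : Type*) [NormedAddCommGroup E] [NormedSpace ℝ E]
  (M : Type*) [TopologicalSpace M] [ChartedSpace E M]

/-- Vector fields on `M`, with no regularity. -/
abbrev VField : Type _ := (x : M) → TangentSpace 𝓘(ℝ, E) x

/-- Distributions on `M`: a linear subspace of each tangent space. -/
abbrev TangentDistribution : Type _ := (x : M) → Submodule ℝ (TangentSpace 𝓘(ℝ, E) x)

variable {E M}

/-- Smooth vector fields. -/
def IsSmoothField [IsManifold 𝓘(ℝ, E) ∞ M] (X : VField E M) : Prop :=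
  ContMDiff 𝓘(ℝ, E) 𝓘(ℝ, E).tangent ∞ (fun x : M => (⟨x, X x⟩ : TangentBundle 𝓘(ℝ, E) M))

/-- `X ∈ Γ(D)`: the vector field `X` is smooth and takes its values in the distribution `D`. -/
structure IsSection [IsManifold 𝓘(ℝ, E) ∞ M] (D : TangentDistribution E M) (X : VField E M) : Prop where
  smooth : IsSmoothField X
  mem : ∀ x, X x ∈ D x

/-- The derivative `X f` of a function `f` along the vector field `X`. -/
def dirDeriv (X : VField E M) (f : M → ℝ) (x : M) : ℝ := mvfderiv 𝓘(ℝ, E) f x (X x)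

/-- The Lie bracket `[X, Y]`. -/
abbrev bracket (X Y : VField E M) : VField E M := VectorField.mlieBracket 𝓘(ℝ, E) X Y

/-- A distribution `D` is integrable if it is tangent to a foliation: around every point there is
a smooth chart `ψ` of `M` in which `D` is a constant subspace `K` of the model space, so that the
slices `ψ⁻¹(c + K)` are integral manifolds of `D`. -/
def IsIntegrable [IsManifold 𝓘(ℝ, E) ∞ M] (D : TangentDistribution E M) : Prop :=
  ∀ x : M, ∃ ψ ∈ IsManifold.maximalAtlas 𝓘(ℝ, E) ∞ M, x ∈ ψ.source ∧
    ∃ K : Submodule ℝ E, ∀ p ∈ ψ.source, ∀ v : TangentSpace 𝓘(ℝ, E) p,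
      v ∈ D p ↔ mvfderiv 𝓘(ℝ, E) ψ p v ∈ K

/-- Tangent spaces of a finite-dimensional manifold are finite-dimensional. -/
instance instFiniteDimensionalTangentSpace [FiniteDimensional ℝ E] (x : M) :
    FiniteDimensional ℝ (TangentSpace 𝓘(ℝ, E) x) :=
  inferInstanceAs (FiniteDimensional ℝ E)

end Basic

/-! ### The Levi-Civita connection -/

section LeviCivita

variable {E : Type*} [NormedAddCommGroup E] [NormedSpace ℝ E] [FiniteDimensional ℝ E]
  {M : Type*} [TopologicalSpace M] [ChartedSpace E M] [IsManifold 𝓘(ℝ, E) ∞ M]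
  [RiemannianBundle (fun x : M => TangentSpace 𝓘(ℝ, E) x)]

/-- The function `g(X, Y)`. -/
def metricFun (X Y : VField E M) (x : M) : ℝ := inner ℝ (X x) (Y x)

/-- The right-hand side of Koszul's formula, divided by two: it equals `g(∇_X Y, Z)`. -/
def koszul (X Y Z : VField E M) (x : M) : ℝ :=
  (1 / 2) * (dirDeriv X (metricFun Y Z) x + dirDeriv Y (metricFun Z X) x
    - dirDeriv Z (metricFun X Y) x + metricFun (bracket X Y) Z x
    - metricFun (bracket X Z) Y x - metricFun (bracket Y Z) X x)

/-- The Levi-Civita connection: `leviCivita Y x v` is `∇_v Y` for `v ∈ T_x M`, that is the vector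
whose inner product with each `e ∈ T_x M` is given by Koszul's formula. Koszul's formula is
tensorial in its first and third arguments, so that `v` and the members `e` of an orthonormal
basis of `T_x M` may be extended to vector fields in any way near `x`. -/
def leviCivita (Y : VField E M) (x : M) (v : TangentSpace 𝓘(ℝ, E) x) : TangentSpace 𝓘(ℝ, E) x :=
  ∑ i, koszul (FiberBundle.extend E v) Y
    (FiberBundle.extend E (stdOrthonormalBasis ℝ (TangentSpace 𝓘(ℝ, E) x) i)) x •
      stdOrthonormalBasis ℝ (TangentSpace 𝓘(ℝ, E) x) i

end LeviCivita

/-! ### Almost contact metric structures and Sasakian structures -/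

section Contact

variable (E : Type*) [NormedAddCommGroup E] [NormedSpace ℝ E]
  (M : Type*) [TopologicalSpace M] [ChartedSpace E M] [IsManifold 𝓘(ℝ, E) ∞ M]

/-- Almost contact structures `(φ, ξ, η)`. -/
structure AlmostContactStructure where
  /-- the `(1, 1)`-tensor field -/
  φ : (x : M) → TangentSpace 𝓘(ℝ, E) x →L[ℝ] TangentSpace 𝓘(ℝ, E) x
  /-- the characteristic vector field -/
  ξ : VField E M
  /-- the `1`-form -/
  η : (x : M) → TangentSpace 𝓘(ℝ, E) x →L[ℝ] ℝ
  smooth_φ : ContMDiff 𝓘(ℝ, E) (𝓘(ℝ, E).prod 𝓘(ℝ, E →L[ℝ] E)) ∞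
    (fun x : M => TotalSpace.mk' (E →L[ℝ] E)
      (E := fun x : M => TangentSpace 𝓘(ℝ, E) x →L[ℝ] TangentSpace 𝓘(ℝ, E) x) x (φ x))
  smooth_ξ : IsSmoothField ξ
  smooth_η : ContMDiff 𝓘(ℝ, E) (𝓘(ℝ, E).prod 𝓘(ℝ, E →L[ℝ] ℝ)) ∞
    (fun x : M => TotalSpace.mk' (E →L[ℝ] ℝ)
      (E := fun x : M => TangentSpace 𝓘(ℝ, E) x →L[ℝ] Trivial M ℝ x) x (η x))
  φ_sq : ∀ (x : M) (v : TangentSpace 𝓘(ℝ, E) x), φ x (φ x v) = -v + η x v • ξ x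
  φ_ξ : ∀ x : M, φ x (ξ x) = 0
  η_φ : ∀ (x : M) (v : TangentSpace 𝓘(ℝ, E) x), η x (φ x v) = 0
  η_ξ : ∀ x : M, η x (ξ x) = 1

variable {E M}

namespace AlmostContactStructure

/-- The vector field `φ X`. -/
def phiField (S : AlmostContactStructure E M) (X : VField E M) : VField E M :=
  fun x => S.φ x (X x)

/-- The exterior derivative of `η`, with the normalization
`dη(X, Y) = (X η(Y) - Y η(X) - η([X, Y])) / 2`. -/
def dEta (S : AlmostContactStructure E M) (X Y : VField E M) (x : M) : ℝ :=
  (1 / 2) * (dirDeriv X (fun p => S.η p (Y p)) x - dirDeriv Y (fun p => S.η p (X p)) x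
    - S.η x (bracket X Y x))

/-- The Nijenhuis tensor of `φ`:
`N(X, Y) = φ²[X, Y] + [φ X, φ Y] - φ[φ X, Y] - φ[X, φ Y]`. -/
def nijenhuis (S : AlmostContactStructure E M) (X Y : VField E M) : VField E M := fun x =>
  S.φ x (S.φ x (bracket X Y x)) + bracket (S.phiField X) (S.phiField Y) x
    - S.φ x (bracket (S.phiField X) Y x) - S.φ x (bracket X (S.phiField Y) x)

/-- Normality: `N + 2 dη ⊗ ξ = 0` (the factor `2` goes with the factor `1 / 2` in `dEta`). -/
def IsNormal (S : AlmostContactStructure E M) : Prop :=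
  ∀ X Y : VField E M, IsSmoothField X → IsSmoothField Y →
    ∀ x, S.nijenhuis X Y x + (2 * S.dEta X Y x) • S.ξ x = 0

end AlmostContactStructure

variable (E M) in
/-- Sasakian structures `(φ, ξ, η, g)` on a manifold with Riemannian metric `g`: normal contact
metric structures. -/
structure SasakianStructure [RiemannianBundle (fun x : M => TangentSpace 𝓘(ℝ, E) x)] extends
    AlmostContactStructure E M where
  /-- compatibility of the metric: `g(φ v, φ w) = g(v, w) - η(v) η(w)` -/
  metric : ∀ (x : M) (v w : TangentSpace 𝓘(ℝ, E) x),
    inner ℝ (φ x v) (φ x w) = inner ℝ v w - η x v * η x w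
  /-- `η` is the dual form of `ξ` -/
  η_eq : ∀ (x : M) (v : TangentSpace 𝓘(ℝ, E) x), η x v = inner ℝ v (ξ x)
  /-- the contact condition `dη(X, Y) = g(X, φ Y)` -/
  contact : ∀ X Y : VField E M, IsSmoothField X → IsSmoothField Y →
    ∀ x, toAlmostContactStructure.dEta X Y x = inner ℝ (X x) (φ x (Y x))
  normal : toAlmostContactStructure.IsNormal

end Contact

/-! ### Riemannian submersions -/

section Submersion

variable {E : Type*} [NormedAddCommGroup E] [NormedSpace ℝ E] [FiniteDimensional ℝ E]
  {M : Type*} [TopologicalSpace M] [ChartedSpace E M] [IsManifold 𝓘(ℝ, E) ∞ M]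
  [RiemannianBundle (fun x : M => TangentSpace 𝓘(ℝ, E) x)]
  {E' : Type*} [NormedAddCommGroup E'] [NormedSpace ℝ E'] [FiniteDimensional ℝ E']
  {N : Type*} [TopologicalSpace N] [ChartedSpace E' N] [IsManifold 𝓘(ℝ, E') ∞ N]
  [RiemannianBundle (fun y : N => TangentSpace 𝓘(ℝ, E') y)]

variable (E E') in
/-- The differential `F_*` of `F` at `x`. -/
abbrev pushforward (F : M → N) (x : M) : TangentSpace 𝓘(ℝ, E) x →L[ℝ] TangentSpace 𝓘(ℝ, E') (F x) :=
  mfderiv 𝓘(ℝ, E) 𝓘(ℝ, E') F x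

variable (E E') in
/-- The vertical distribution `ker F_*`. -/
def vertical (F : M → N) : TangentDistribution E M := fun x =>
  LinearMap.ker (pushforward E E' F x).toLinearMap

variable (E E') in
/-- The horizontal distribution `(ker F_*)^⊥`. -/
def horizontal (F : M → N) : TangentDistribution E M := fun x => (vertical E E' F x)ᗮ

variable (E E') in
/-- Riemannian submersions: smooth maps onto `N`, of maximal rank, whose differential preserves
the lengths of horizontal vectors. -/
structure IsRiemannianSubmersion (F : M → N) : Prop where
  smooth : ContMDiff 𝓘(ℝ, E) 𝓘(ℝ, E') ∞ F
  onto : Function.Surjective F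
  maximal_rank : ∀ x, Function.Surjective (pushforward E E' F x)
  isometry : ∀ x, ∀ v ∈ horizontal E E' F x, ‖pushforward E E' F x v‖ = ‖v‖

variable (E E') in
/-- The vertical part `𝒱 X` of a vector field. -/
def verPart (F : M → N) (X : VField E M) : VField E M := fun x =>
  (vertical E E' F x).starProjection (X x)

variable (E E') in
/-- The horizontal part `ℋ X` of a vector field. -/
def horPart (F : M → N) (X : VField E M) : VField E M := fun x =>
  (horizontal E E' F x).starProjection (X x)

variable (E E') in
/-- O'Neill's tensor `𝒜_X Y = 𝒱 ∇_{ℋ X} (ℋ Y) + ℋ ∇_{ℋ X} (𝒱 Y)`. -/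
def oneillA (F : M → N) (X Y : VField E M) : VField E M := fun x =>
  verPart E E' F (fun p => leviCivita (horPart E E' F Y) p (horPart E E' F X p)) x
    + horPart E E' F (fun p => leviCivita (verPart E E' F Y) p (horPart E E' F X p)) x

variable (E E') in
/-- The pullback `∇^F` of the Levi-Civita connection of `N` along `F : M → N`: for a section `σ`
of `F⁻¹ TN` and `v ∈ T_x M`. Near `x` one has `σ p = ∑ i, σⁱ p • e_i (F p)` with the coordinate
frame `e_i` of the trivialization of `TN` at `F x`, and the two terms are
`∑ i, (v σⁱ) • e_i (F x)` and `∑ i, σⁱ x • ∇_{F_* v} e_i`. -/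
def pullbackConnection (F : M → N) (σ : (p : M) → TangentSpace 𝓘(ℝ, E') (F p)) (x : M)
    (v : TangentSpace 𝓘(ℝ, E) x) : TangentSpace 𝓘(ℝ, E') (F x) :=
  letI t := trivializationAt E' (fun y : N => TangentSpace 𝓘(ℝ, E') y) (F x)
  t.symm (F x) (mvfderiv 𝓘(ℝ, E) (fun p : M => (t ⟨F p, σ p⟩).2) x v)
    + leviCivita (fun y : N => t.symm y (t ⟨F x, σ x⟩).2) (F x) (pushforward E E' F x v)

variable (E E') in
/-- The second fundamental form `(∇F_*)(X, Y) = ∇^F_X (F_* Y) - F_* (∇_X Y)` of `F`. -/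
def secondFundamentalForm (F : M → N) (X Y : VField E M) (x : M) : TangentSpace 𝓘(ℝ, E') (F x) :=
  pullbackConnection E E' F (fun p => pushforward E E' F p (Y p)) x (X x)
    - pushforward E E' F x (leviCivita Y x (X x))

variable (E') in
/-- The distribution `μ`: the orthogonal complement of `φ (ker F_*)` in `(ker F_*)^⊥`. -/
def muDist (S : AlmostContactStructure E M) (F : M → N) : TangentDistribution E M := fun x =>
  horizontal E E' F x ⊓ ((vertical E E' F x).map (S.φ x).toLinearMap)ᗮ

variable (E') in
/-- The `μ`-component `C X` of `φ X` in the decomposition `φ X = B X + C X`, with `B X` vertical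
and `C X ∈ μ`, for horizontal `X`. -/
def cPart (S : AlmostContactStructure E M) (F : M → N) (X : VField E M) : VField E M := fun x =>
  (muDist E' S F x).starProjection (S.φ x (X x))

end Submersion

end

/-! Everything rests on one identity for horizontal `X`, `Y` and vertical `V`: `g([X, Y], V)` is the
right side of (iii) minus its left side (`metricFun_bracket_of_horizontal`). It is the
antisymmetrization in `X`, `Y` of a formula for `g(∇_X Y, V)`. That formula comes from moving `φ`
across `∇` with the Sasakian identity `(∇_X φ) Y = g(X, Y) ξ - η(Y) X` (`nablaPhi_eq`), splitting `φ
Y = C Y - A_Y ξ`, and using that `C Y` is orthogonal to `φ (ker F_*)`. So (iii) says exactly that no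
bracket of horizontal fields has a vertical component.

Integrability gives this involutivity, because a flattening chart turns horizontal fields into
fields with values in a fixed subspace. The converse needs no Frobenius theorem. For vertical `V`,
both `ξ` and `φ V` are horizontal, and `g([ξ, φ V], V) = -2 g(V, V)`. Involutivity therefore forces
`ker F_* = 0`, and the whole tangent bundle is trivially integrable. In particular, all three
assertions hold only when `ker F_*` vanishes.

The passage between (ii) and (iii) is pointwise: `A_Y ξ` is vertical, so `(∇F_*)(X, A_Y ξ) =
-F_*(∇_X A_Y ξ)`, and `F_*` preserves inner products with the horizontal vector `φ V`.

The Sasakian identity is derived from the definition: `dΦ = 0` (as `Φ = dη`), `ξ` commutes with `φ`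
and is Killing, and closedness combined with normality leaves no room for a defect in the formula
for `∇φ`. -/

noncomputable section
set_option linter.unusedSectionVars false

/-! ### The Lie bracket as a commutator of derivations. -/

section LieBracketDerivation
open VectorField Topology

variable {E : Type*} [NormedAddCommGroup E] [NormedSpace ℝ E] [CompleteSpace E]
  {M : Type*} [TopologicalSpace M] [ChartedSpace E M] [IsManifold 𝓘(ℝ, E) 2 M]
  {G : Type*} [NormedAddCommGroup G] [NormedSpace ℝ G]

/-- The vector field `Y` read in the preferred chart at `x`. -/
def chartField (x : M) (Y : VField E M) : E → E :=
  mpullbackWithin 𝓘(ℝ, E) 𝓘(ℝ, E) (extChartAt 𝓘(ℝ, E) x).symm Y (Set.range 𝓘(ℝ, E))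

/-- The chain rule in the chart. It is needed on a whole neighbourhood, since the function `Y u` is
differentiated once more. -/
theorem eventually_mvfderiv_apply_eq {u : M → G} {x : M} (Y : VField E M)
    (hu : ContMDiffAt 𝓘(ℝ, E) 𝓘(ℝ, G) 2 u x) :
    (fun p => mvfderiv 𝓘(ℝ, E) u p (Y p)) =ᶠ[𝓝 x]
      (fun y => fderiv ℝ (u ∘ (extChartAt 𝓘(ℝ, E) x).symm) y (chartField x Y y)) ∘
        (extChartAt 𝓘(ℝ, E) x) := by
  have : IsManifold 𝓘(ℝ, E) 1 M := IsManifold.of_le (n := 2) one_le_two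
  filter_upwards [(contMDiffAt_iff_contMDiffAt_nhds (by simp)).1 hu,
    extChartAt_source_mem_nhds (I := 𝓘(ℝ, E)) x] with p hp hps
  have hpt : extChartAt 𝓘(ℝ, E) x p ∈ (extChartAt 𝓘(ℝ, E) x).target :=
    (extChartAt 𝓘(ℝ, E) x).map_source hps
  have hinv := isInvertible_mfderivWithin_extChartAt_symm (I := 𝓘(ℝ, E)) hpt
  have hd := mdifferentiableWithinAt_extChartAt_symm (I := 𝓘(ℝ, E)) hpt
  have hl := (extChartAt 𝓘(ℝ, E) x).left_inv hps
  simp only [Function.comp_apply, chartField, mpullbackWithin_apply]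
  -- Tangent spaces depend on the base point, so `p` cannot be rewritten freely; with the chart and
  -- its value made variables, `p` is replaced throughout by `φ z`.
  generalize (extChartAt 𝓘(ℝ, E) x).symm = φ at *
  generalize extChartAt 𝓘(ℝ, E) x p = z at *
  simp only [modelWithCornersSelf_coe, Set.range_id, mfderivWithin_univ,
    mdifferentiableWithinAt_univ] at hinv hd ⊢
  subst hl
  have hup : MDifferentiableAt 𝓘(ℝ, E) 𝓘(ℝ, G) u (φ z) := hp.mdifferentiableAt (by simp)
  have hc := mfderiv_comp z hup hd
  rw [mfderiv_eq_fderiv] at hc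
  have key : ∀ w, fderiv ℝ (u ∘ φ) z ((mfderiv 𝓘(ℝ, E) 𝓘(ℝ, E) φ z).inverse w)
      = mfderiv 𝓘(ℝ, E) 𝓘(ℝ, G) u (φ z) w := by
    intro w
    rw [hc]
    exact congrArg (mfderiv 𝓘(ℝ, E) 𝓘(ℝ, G) u (φ z)) (hinv.self_apply_inverse w)
  exact (key _).symm

/-- The tangent space at `x` is identified with `E` by the preferred chart at `x`, so the derivative
of that chart at its own centre is the identity. -/
theorem chartField_extChartAt (x : M) (Y : VField E M) :
    chartField x Y (extChartAt 𝓘(ℝ, E) x x) = Y x := by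
  have : IsManifold 𝓘(ℝ, E) 1 M := IsManifold.of_le (n := 2) one_le_two
  have h := mfderivWithin_range_extChartAt_symm (I := 𝓘(ℝ, E)) (x := x)
  have hl := extChartAt_to_inv (I := 𝓘(ℝ, E)) x
  simp only [chartField, mpullbackWithin_apply]
  generalize (extChartAt 𝓘(ℝ, E) x).symm = φ at *
  generalize extChartAt 𝓘(ℝ, E) x x = z at *
  subst hl
  rw [h]
  exact DFunLike.congr_fun (ContinuousLinearMap.inverse_id (R := ℝ) (M := E)) (Y (φ z) : E)

theorem differentiableAt_chartField {x : M} {Y : VField E M}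
    (hY : MDifferentiableAt 𝓘(ℝ, E) 𝓘(ℝ, E).tangent
      (fun p => (⟨p, Y p⟩ : TangentBundle 𝓘(ℝ, E) M)) x) :
    DifferentiableAt ℝ (chartField x Y) (extChartAt 𝓘(ℝ, E) x x) := by
  have h : DifferentiableWithinAt ℝ (chartField x Y) _ _ :=
    (mdifferentiableWithinAt_univ.2 hY).differentiableWithinAt_mpullbackWithin_vectorField
  rwa [Set.preimage_univ, Set.univ_inter, modelWithCornersSelf_coe, Set.range_id,
    differentiableWithinAt_univ] at h

theorem mlieBracket_eq_lieBracket_chartField (x : M) (X Y : VField E M) :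
    mlieBracket 𝓘(ℝ, E) X Y x =
      lieBracket ℝ (chartField x X) (chartField x Y) (extChartAt 𝓘(ℝ, E) x x) := by
  have : IsManifold 𝓘(ℝ, E) 1 M := IsManifold.of_le (n := 2) one_le_two
  have h : mlieBracket 𝓘(ℝ, E) X Y x =
      (mfderiv 𝓘(ℝ, E) 𝓘(ℝ, E) (extChartAt 𝓘(ℝ, E) x) x).inverse
        (lieBracketWithin (E := E) ℝ (chartField x X) (chartField x Y)
          ((extChartAt 𝓘(ℝ, E) x).symm ⁻¹' Set.univ ∩ Set.range 𝓘(ℝ, E))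
            (extChartAt 𝓘(ℝ, E) x x) : E) := by
    rw [← mlieBracketWithin_univ, mlieBracketWithin_apply]
    rfl
  rw [h, mfderiv_extChartAt_self, Set.preimage_univ, Set.univ_inter, modelWithCornersSelf_coe,
    Set.range_id, lieBracketWithin_univ]
  exact DFunLike.congr_fun (ContinuousLinearMap.inverse_id (R := ℝ) (M := E)) _

theorem contDiffAt_comp_extChartAt_symm {u : M → G} {x : M}
    (hu : ContMDiffAt 𝓘(ℝ, E) 𝓘(ℝ, G) 2 u x) :
    ContDiffAt ℝ 2 (u ∘ (extChartAt 𝓘(ℝ, E) x).symm) (extChartAt 𝓘(ℝ, E) x x) := by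
  have h := (contMDiffAt_iff.1 hu).2
  simpa using! h

theorem hasMFDerivAt_mvfderiv_apply {u : M → G} {x : M} {Y : VField E M}
    (hu : ContMDiffAt 𝓘(ℝ, E) 𝓘(ℝ, G) 2 u x)
    (hY : MDifferentiableAt 𝓘(ℝ, E) 𝓘(ℝ, E).tangent
      (fun p => (⟨p, Y p⟩ : TangentBundle 𝓘(ℝ, E) M)) x) :
    HasMFDerivAt 𝓘(ℝ, E) 𝓘(ℝ, G) (fun p => mvfderiv 𝓘(ℝ, E) u p (Y p)) x
      (fderiv ℝ (fun y => fderiv ℝ (u ∘ (extChartAt 𝓘(ℝ, E) x).symm) y (chartField x Y y))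
        (extChartAt 𝓘(ℝ, E) x x)) := by
  have : IsManifold 𝓘(ℝ, E) 1 M := IsManifold.of_le (n := 2) one_le_two
  refine HasMFDerivAt.congr_of_eventuallyEq ?_ (eventually_mvfderiv_apply_eq Y hu)
  have h1 := (mdifferentiableAt_extChartAt (I := 𝓘(ℝ, E)) (mem_chart_source E x)).hasMFDerivAt
  rw [mfderiv_extChartAt_self] at h1
  have hu' := contDiffAt_comp_extChartAt_symm hu
  have h2 : DifferentiableAt ℝ
      (fun y => fderiv ℝ (u ∘ (extChartAt 𝓘(ℝ, E) x).symm) y (chartField x Y y))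
        (extChartAt 𝓘(ℝ, E) x x) :=
    ((hu'.fderiv_right (m := 1) (by norm_num)).differentiableAt (by simp)).clm_apply
      (differentiableAt_chartField hY)
  exact (h2.hasFDerivAt.hasMFDerivAt).comp x h1

theorem mdifferentiableAt_mvfderiv_apply {u : M → G} {x : M} {Y : VField E M}
    (hu : ContMDiffAt 𝓘(ℝ, E) 𝓘(ℝ, G) 2 u x)
    (hY : MDifferentiableAt 𝓘(ℝ, E) 𝓘(ℝ, E).tangent
      (fun p => (⟨p, Y p⟩ : TangentBundle 𝓘(ℝ, E) M)) x) :
    MDifferentiableAt 𝓘(ℝ, E) 𝓘(ℝ, G) (fun p => mvfderiv 𝓘(ℝ, E) u p (Y p)) x :=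
  (hasMFDerivAt_mvfderiv_apply hu hY).mdifferentiableAt

/-- Product rule for `Du(Y)` in the chart: a Hessian term, which will cancel in commutators, and a
term differentiating `Y`. -/
theorem mvfderiv_mvfderiv_apply {u : M → G} {x : M} {Y : VField E M}
    (hu : ContMDiffAt 𝓘(ℝ, E) 𝓘(ℝ, G) 2 u x)
    (hY : MDifferentiableAt 𝓘(ℝ, E) 𝓘(ℝ, E).tangent
      (fun p => (⟨p, Y p⟩ : TangentBundle 𝓘(ℝ, E) M)) x) (v : E) :
    mvfderiv 𝓘(ℝ, E) (fun p => mvfderiv 𝓘(ℝ, E) u p (Y p)) x v =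
      fderiv ℝ (fderiv ℝ (u ∘ (extChartAt 𝓘(ℝ, E) x).symm)) (extChartAt 𝓘(ℝ, E) x x) v (Y x) +
      fderiv ℝ (u ∘ (extChartAt 𝓘(ℝ, E) x).symm) (extChartAt 𝓘(ℝ, E) x x)
        (fderiv ℝ (chartField x Y) (extChartAt 𝓘(ℝ, E) x x) v) := by
  have h := (hasMFDerivAt_mvfderiv_apply hu hY).mfderiv
  have hu' := contDiffAt_comp_extChartAt_symm hu
  have h' := fderiv_clm_apply ((hu'.fderiv_right (m := 1) (by norm_num)).differentiableAt (by simp))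
    (differentiableAt_chartField hY)
  refine (DFunLike.congr_fun (h.trans h') v).trans ?_
  rw [chartField_extChartAt]
  exact add_comm _ _

/-- The Lie bracket acts on vector-valued functions as the commutator of derivations. -/
theorem mvfderiv_mlieBracket {u : M → G} {x : M} {X Y : VField E M}
    (hu : ContMDiffAt 𝓘(ℝ, E) 𝓘(ℝ, G) 2 u x)
    (hX : MDifferentiableAt 𝓘(ℝ, E) 𝓘(ℝ, E).tangent
      (fun p => (⟨p, X p⟩ : TangentBundle 𝓘(ℝ, E) M)) x)
    (hY : MDifferentiableAt 𝓘(ℝ, E) 𝓘(ℝ, E).tangent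
      (fun p => (⟨p, Y p⟩ : TangentBundle 𝓘(ℝ, E) M)) x) :
    mvfderiv 𝓘(ℝ, E) u x (mlieBracket 𝓘(ℝ, E) X Y x) =
      mvfderiv 𝓘(ℝ, E) (fun p => mvfderiv 𝓘(ℝ, E) u p (Y p)) x (X x) -
        mvfderiv 𝓘(ℝ, E) (fun p => mvfderiv 𝓘(ℝ, E) u p (X p)) x (Y x) := by
  have hu' := contDiffAt_comp_extChartAt_symm hu
  -- Symmetry of the Hessian cancels the second-order terms; what is left is `Du` applied to the
  -- bracket in the chart.
  have hs := (hu'.isSymmSndFDerivAt (by simp)).eq (X x : E) (Y x : E)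
  have e1 := mvfderiv_mvfderiv_apply hu hY (X x)
  have e2 := mvfderiv_mvfderiv_apply hu hX (Y x)
  have e3 : ∀ v : E, mvfderiv 𝓘(ℝ, E) u x v =
      fderiv ℝ (u ∘ (extChartAt 𝓘(ℝ, E) x).symm) (extChartAt 𝓘(ℝ, E) x x) v := by
    intro v
    have h := (hu.mdifferentiableAt (by simp)).mvfderiv
    rw [h, modelWithCornersSelf_coe, Set.range_id, fderivWithin_univ]
    rfl
  refine (e3 _).trans ?_
  refine Eq.trans ?_ (congrArg₂ (· - ·) e1 e2).symm
  rw [mlieBracket_eq_lieBracket_chartField, lieBracket, map_sub]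
  rw [chartField_extChartAt, chartField_extChartAt, hs]
  abel

end LieBracketDerivation

/-! ### Smooth vector fields and their brackets. -/

section SmoothFields
open VectorField Topology

variable {E : Type*} [NormedAddCommGroup E] [NormedSpace ℝ E]
  {M : Type*} [TopologicalSpace M] [ChartedSpace E M] [IsManifold 𝓘(ℝ, E) ∞ M]

/-- Differentiability of a vector field at a point. -/
abbrev DiffFieldAt (X : VField E M) (x : M) : Prop :=
  MDifferentiableAt 𝓘(ℝ, E) 𝓘(ℝ, E).tangent (fun p => (⟨p, X p⟩ : TangentBundle 𝓘(ℝ, E) M)) x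

theorem IsSmoothField.diffFieldAt {X : VField E M} (hX : IsSmoothField X) (x : M) :
    DiffFieldAt X x :=
  (hX x).mdifferentiableAt (by simp)

theorem two_le_infty : (2 : WithTop ℕ∞) ≤ ∞ := ENat.LEInfty.out

theorem IsSmoothField.add {X Y : VField E M} (hX : IsSmoothField X) (hY : IsSmoothField Y) :
    IsSmoothField (X + Y) :=
  ContMDiff.add_section hX hY

theorem IsSmoothField.sub {X Y : VField E M} (hX : IsSmoothField X) (hY : IsSmoothField Y) :
    IsSmoothField (X - Y) :=
  ContMDiff.sub_section hX hY

theorem IsSmoothField.neg {X : VField E M} (hX : IsSmoothField X) : IsSmoothField (-X) :=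
  ContMDiff.neg_section hX

theorem IsSmoothField.smul {f : M → ℝ} {X : VField E M} (hf : ContMDiff 𝓘(ℝ, E) 𝓘(ℝ) ∞ f)
    (hX : IsSmoothField X) : IsSmoothField (f • X) :=
  ContMDiff.smul_section hf hX

theorem isSmoothField_zero : IsSmoothField (0 : VField E M) :=
  contMDiff_zeroSection ℝ (TangentSpace 𝓘(ℝ, E))

variable [CompleteSpace E]

theorem IsSmoothField.bracket {X Y : VField E M} (hX : IsSmoothField X) (hY : IsSmoothField Y) :
    IsSmoothField (bracket X Y) := by
  have : IsManifold 𝓘(ℝ, E) ((⊤ : ℕ∞) + 1) M := by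
    simpa using (inferInstance : IsManifold 𝓘(ℝ, E) ∞ M)
  have : IsManifold 𝓘(ℝ, E) (minSmoothness ℝ 2) M := by
    simp only [minSmoothness_of_isRCLikeNormedField]; infer_instance
  exact ContDiff.mlieBracket_vectorField (m := ⊤) (n := ⊤) hX hY (by simp)

theorem bracket_swap (X Y : VField E M) (x : M) : bracket X Y x = -bracket Y X x :=
  mlieBracket_swap_apply

theorem bracket_jacobi {X Y Z : VField E M} (hX : IsSmoothField X) (hY : IsSmoothField Y)
    (hZ : IsSmoothField Z) (x : M) :
    bracket X (bracket Y Z) x = bracket (bracket X Y) Z x + bracket Y (bracket X Z) x := by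
  have : IsManifold 𝓘(ℝ, E) (minSmoothness ℝ 3) M := by
    simp only [minSmoothness_of_isRCLikeNormedField]; infer_instance
  apply leibniz_identity_mlieBracket_apply
  · exact (hX x).of_le (by simpa using two_le_infty)
  · exact (hY x).of_le (by simpa using two_le_infty)
  · exact (hZ x).of_le (by simpa using two_le_infty)

theorem dirDeriv_bracket {f : M → ℝ} (hf : ContMDiff 𝓘(ℝ, E) 𝓘(ℝ) ∞ f) {X Y : VField E M}
    (hX : IsSmoothField X) (hY : IsSmoothField Y) (x : M) :
    dirDeriv (bracket X Y) f x = dirDeriv X (dirDeriv Y f) x - dirDeriv Y (dirDeriv X f) x :=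
  mvfderiv_mlieBracket ((hf x).of_le two_le_infty) (hX.diffFieldAt x) (hY.diffFieldAt x)

theorem mdiff_dirDeriv {f : M → ℝ} (hf : ContMDiff 𝓘(ℝ, E) 𝓘(ℝ) ∞ f) {X : VField E M}
    (hX : IsSmoothField X) (x : M) : MDifferentiableAt 𝓘(ℝ, E) 𝓘(ℝ) (dirDeriv X f) x :=
  mdifferentiableAt_mvfderiv_apply ((hf x).of_le two_le_infty) (hX.diffFieldAt x)

end SmoothFields

/-! ### Rules for directional derivatives. -/

section DirDeriv

variable {E : Type*} [NormedAddCommGroup E] [NormedSpace ℝ E]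
  {M : Type*} [TopologicalSpace M] [ChartedSpace E M]

theorem dirDeriv_add {f g : M → ℝ} {x : M} (X : VField E M)
    (hf : MDifferentiableAt 𝓘(ℝ, E) 𝓘(ℝ) f x) (hg : MDifferentiableAt 𝓘(ℝ, E) 𝓘(ℝ) g x) :
    dirDeriv X (f + g) x = dirDeriv X f x + dirDeriv X g x := by
  simp only [dirDeriv, mvfderiv_add hf hg]; rfl

theorem dirDeriv_sub {f g : M → ℝ} {x : M} (X : VField E M)
    (hf : MDifferentiableAt 𝓘(ℝ, E) 𝓘(ℝ) f x) (hg : MDifferentiableAt 𝓘(ℝ, E) 𝓘(ℝ) g x) :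
    dirDeriv X (f - g) x = dirDeriv X f x - dirDeriv X g x := by
  simp only [dirDeriv, mvfderiv_sub hf hg]; rfl

theorem dirDeriv_mul {f g : M → ℝ} {x : M} (X : VField E M)
    (hf : MDifferentiableAt 𝓘(ℝ, E) 𝓘(ℝ) f x) (hg : MDifferentiableAt 𝓘(ℝ, E) 𝓘(ℝ) g x) :
    dirDeriv X (f * g) x = dirDeriv X f x * g x + f x * dirDeriv X g x := by
  simp only [dirDeriv, mvfderiv_mul hf hg]
  simp
  ring

theorem dirDeriv_const (X : VField E M) (c : ℝ) (x : M) : dirDeriv X (fun _ => c) x = 0 := by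
  rw [dirDeriv, mvfderiv_const]; rfl

theorem dirDeriv_const_mul {f : M → ℝ} {x : M} (X : VField E M) (c : ℝ)
    (hf : MDifferentiableAt 𝓘(ℝ, E) 𝓘(ℝ) f x) :
    dirDeriv X (fun p => c * f p) x = c * dirDeriv X f x := by
  have := dirDeriv_mul X (mdifferentiableAt_const (c := c)) hf
  rw [dirDeriv_const, zero_mul, zero_add] at this
  exact this

theorem dirDeriv_add_left (f : M → ℝ) (x : M) (X Y : VField E M) :
    dirDeriv (X + Y) f x = dirDeriv X f x + dirDeriv Y f x :=
  map_add (mvfderiv 𝓘(ℝ, E) f x) _ _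

theorem dirDeriv_smul_left (f h : M → ℝ) (x : M) (X : VField E M) :
    dirDeriv (h • X) f x = h x * dirDeriv X f x :=
  map_smul (mvfderiv 𝓘(ℝ, E) f x) _ _

end DirDeriv

/-! ### The Levi-Civita connection from Koszul's formula. -/

section LeviCivitaProperties
open VectorField Topology

variable {E : Type*} [NormedAddCommGroup E] [NormedSpace ℝ E] [FiniteDimensional ℝ E]
  {M : Type*} [TopologicalSpace M] [ChartedSpace E M] [IsManifold 𝓘(ℝ, E) ∞ M]
  [RiemannianBundle (fun x : M => TangentSpace 𝓘(ℝ, E) x)]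
  [IsContMDiffRiemannianBundle 𝓘(ℝ, E) ∞ E (fun x : M => TangentSpace 𝓘(ℝ, E) x)]

theorem contMDiff_metricFun {X Y : VField E M} (hX : IsSmoothField X) (hY : IsSmoothField Y) :
    ContMDiff 𝓘(ℝ, E) 𝓘(ℝ) ∞ (metricFun X Y) :=
  ContMDiff.inner_bundle hX hY

theorem DiffFieldAt.metricFun {X Y : VField E M} {x : M} (hX : DiffFieldAt X x)
    (hY : DiffFieldAt Y x) : MDifferentiableAt 𝓘(ℝ, E) 𝓘(ℝ) (metricFun X Y) x :=
  MDifferentiableAt.inner_bundle hX hY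

theorem metricFun_comm (X Y : VField E M) : metricFun X Y = metricFun Y X :=
  funext fun _ => real_inner_comm _ _

theorem metricFun_add_left (X Y Z : VField E M) :
    metricFun (X + Y) Z = metricFun X Z + metricFun Y Z :=
  funext fun _ => inner_add_left _ _ _

theorem metricFun_smul_left (f : M → ℝ) (X Z : VField E M) :
    metricFun (f • X) Z = f * metricFun X Z :=
  funext fun _ => real_inner_smul_left _ _ _

theorem metricFun_add_right (X Y Z : VField E M) :
    metricFun Z (X + Y) = metricFun Z X + metricFun Z Y :=
  funext fun _ => inner_add_right _ _ _

theorem metricFun_smul_right (f : M → ℝ) (X Z : VField E M) :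
    metricFun Z (f • X) = f * metricFun Z X :=
  funext fun _ => real_inner_smul_right _ _ _

/-- Metric compatibility at the level of Koszul's expression: all terms antisymmetric in `Y`, `Z`
cancel, without any regularity. -/
theorem koszul_add_koszul_swap {Y Z : VField E M} (X : VField E M) (x : M) :
    koszul X Y Z x + koszul X Z Y x = dirDeriv X (metricFun Y Z) x := by
  simp only [koszul, metricFun_comm Z Y, metricFun_comm Z X, metricFun_comm Y X]
  have : metricFun (bracket Z Y) X x = - metricFun (bracket Y Z) X x := by
    simp only [metricFun]
    rw [bracket_swap Z Y, inner_neg_left]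
  rw [this]
  ring

/-- Vanishing torsion at the level of Koszul's expression. -/
theorem koszul_sub_koszul_swap {Y Z : VField E M} (X : VField E M) (x : M) :
    koszul X Y Z x - koszul Y X Z x = metricFun (bracket X Y) Z x := by
  simp only [koszul, metricFun_comm Z Y, metricFun_comm Z X, metricFun_comm Y X]
  have : metricFun (bracket Y X) Z x = - metricFun (bracket X Y) Z x := by
    simp only [metricFun]
    rw [bracket_swap Y X, inner_neg_left]
  rw [this]
  ring

/-- The derivatives of a factor `f` of `Z` produced by the metric terms are cancelled by those from
`[X, f Z]` and `[Y, f Z]`. -/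
theorem koszul_tensorial_right {X Y : VField E M} {x : M} (hX : DiffFieldAt X x)
    (hY : DiffFieldAt Y x) : TensorialAt 𝓘(ℝ, E) E (fun Z => koszul X Y Z x) x where
  smul {f Z} hf hZ := by
    have h1 := mlieBracket_smul_right (V := X) hf hZ
    have h2 := mlieBracket_smul_right (V := Y) hf hZ
    simp only [koszul, metricFun_smul_right, metricFun_smul_left, dirDeriv_smul_left,
      dirDeriv_mul _ hf (hY.metricFun hZ), dirDeriv_mul _ hf (DiffFieldAt.metricFun hZ hX)]
    simp only [metricFun, h1, h2, inner_add_left, real_inner_smul_left, Pi.mul_apply, dirDeriv,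
      smul_eq_mul, real_inner_comm (X x) (Z x), real_inner_comm (Y x) (Z x)]
    ring
  add {Z Z'} hZ hZ' := by
    have h1 := mlieBracket_add_right (V := X) hZ hZ'
    have h2 := mlieBracket_add_right (V := Y) hZ hZ'
    simp only [koszul, metricFun_add_right, metricFun_add_left, dirDeriv_add_left,
      dirDeriv_add _ (hY.metricFun hZ) (hY.metricFun hZ'),
      dirDeriv_add _ (DiffFieldAt.metricFun hZ hX) (DiffFieldAt.metricFun hZ' hX)]
    simp only [metricFun, h1, h2, inner_add_left, Pi.add_apply]
    ring

theorem koszul_tensorial_left {Y Z : VField E M} {x : M} (hY : DiffFieldAt Y x)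
    (hZ : DiffFieldAt Z x) : TensorialAt 𝓘(ℝ, E) E (fun X => koszul X Y Z x) x where
  smul {f X} hf hX := by
    have h1 := mlieBracket_smul_left (W := Y) hf hX
    have h2 := mlieBracket_smul_left (W := Z) hf hX
    simp only [koszul, metricFun_smul_right, metricFun_smul_left, dirDeriv_smul_left,
      dirDeriv_mul _ hf (hZ.metricFun hX), dirDeriv_mul _ hf (DiffFieldAt.metricFun hX hY)]
    simp only [metricFun, h1, h2, inner_add_left, real_inner_smul_left, Pi.mul_apply, dirDeriv,
      smul_eq_mul, real_inner_comm (X x) (Z x), real_inner_comm (Y x) (X x), neg_mul]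
    ring
  add {X X'} hX hX' := by
    have h1 := mlieBracket_add_left (W := Y) hX hX'
    have h2 := mlieBracket_add_left (W := Z) hX hX'
    simp only [koszul, metricFun_add_right, metricFun_add_left, dirDeriv_add_left,
      dirDeriv_add _ (hZ.metricFun hX) (hZ.metricFun hX'),
      dirDeriv_add _ (DiffFieldAt.metricFun hX hY) (DiffFieldAt.metricFun hX' hY)]
    simp only [metricFun, h1, h2, inner_add_left, Pi.add_apply]
    ring

/-- The Levi-Civita connection is characterized by Koszul's formula. -/
theorem inner_leviCivita {X Y Z : VField E M} {x : M} (hX : DiffFieldAt X x)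
    (hY : DiffFieldAt Y x) (hZ : DiffFieldAt Z x) :
    inner ℝ (leviCivita Y x (X x)) (Z x) = koszul X Y Z x := by
  have hext : ∀ v : TangentSpace 𝓘(ℝ, E) x, DiffFieldAt (FiberBundle.extend E v) x :=
    fun v => FiberBundle.mdifferentiableAt_extend 𝓘(ℝ, E) E v
  -- Tensoriality in the third slot makes Koszul's expression a linear functional on `T_x M`, and
  -- the defining sum is its Riesz representative; tensoriality in the first slot then replaces the
  -- extension of `X x` by `X`.
  have hT := koszul_tensorial_right (hext (X x)) hY
  have hsum : leviCivita Y x (X x) =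
      ∑ i, TensorialAt.mkHom _ x hT (stdOrthonormalBasis ℝ (TangentSpace 𝓘(ℝ, E) x) i) •
        stdOrthonormalBasis ℝ (TangentSpace 𝓘(ℝ, E) x) i := rfl
  have h1 : inner ℝ (leviCivita Y x (X x)) (Z x) = TensorialAt.mkHom _ x hT (Z x) := by
    conv_rhs => rw [← (stdOrthonormalBasis ℝ (TangentSpace 𝓘(ℝ, E) x)).sum_repr' (Z x)]
    rw [hsum, sum_inner, map_sum]
    refine Finset.sum_congr rfl fun i _ => ?_
    rw [map_smul, real_inner_smul_left, smul_eq_mul, mul_comm]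
  rw [h1, TensorialAt.mkHom_apply hT hZ]
  exact (koszul_tensorial_left hY hZ).pointwise (hext _) hX (by simp)

/-- Removes the half of `oneillA` in which the projected field is identically zero, and the
connection term of `pullbackConnection` for the zero section. -/
theorem leviCivita_zero (x : M) (v : TangentSpace 𝓘(ℝ, E) x) :
    leviCivita (0 : VField E M) x v = 0 := by
  have hz : DiffFieldAt (0 : VField E M) x := isSmoothField_zero.diffFieldAt x
  have h0 : ∀ Z : VField E M, metricFun Z (0 : VField E M) = fun _ => 0 :=
    fun Z => funext fun p => inner_zero_right _
  have h0' : ∀ Z : VField E M, metricFun (0 : VField E M) Z = fun _ => 0 :=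
    fun Z => funext fun p => inner_zero_left _
  have hb : ∀ Z : VField E M, bracket Z (0 : VField E M) = 0 := fun Z => mlieBracket_zero_right
  have hb' : ∀ Z : VField E M, bracket (0 : VField E M) Z = 0 := fun Z => mlieBracket_zero_left
  refine Finset.sum_eq_zero fun i _ => ?_
  simp only [koszul, h0, h0', hb, hb', dirDeriv_const]
  simp [dirDeriv]

/-- The vector field `∇_X Y`. -/
def covDeriv (X Y : VField E M) : VField E M := fun x => leviCivita Y x (X x)

variable {X Y Z : VField E M}

theorem metricFun_covDeriv (hX : IsSmoothField X) (hY : IsSmoothField Y) (hZ : IsSmoothField Z)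
    (x : M) : metricFun (covDeriv X Y) Z x = koszul X Y Z x :=
  inner_leviCivita (hX.diffFieldAt x) (hY.diffFieldAt x) (hZ.diffFieldAt x)

/-- The Levi-Civita connection is metric. -/
theorem dirDeriv_metricFun (hX : IsSmoothField X) (hY : IsSmoothField Y) (hZ : IsSmoothField Z)
    (x : M) : dirDeriv X (metricFun Y Z) x =
      metricFun (covDeriv X Y) Z x + metricFun (covDeriv X Z) Y x := by
  rw [metricFun_covDeriv hX hY hZ, metricFun_covDeriv hX hZ hY, koszul_add_koszul_swap]

/-- The Levi-Civita connection is torsion-free. -/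
theorem metricFun_bracket (hX : IsSmoothField X) (hY : IsSmoothField Y) (hZ : IsSmoothField Z)
    (x : M) : metricFun (bracket X Y) Z x =
      metricFun (covDeriv X Y) Z x - metricFun (covDeriv Y X) Z x := by
  rw [metricFun_covDeriv hX hY hZ, metricFun_covDeriv hY hX hZ, koszul_sub_koszul_swap]

theorem metricFun_covDeriv_add_left {X' : VField E M} (hX : IsSmoothField X)
    (hX' : IsSmoothField X') (hY : IsSmoothField Y) (hZ : IsSmoothField Z) (x : M) :
    metricFun (covDeriv (X + X') Y) Z x =
      metricFun (covDeriv X Y) Z x + metricFun (covDeriv X' Y) Z x := by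
  rw [metricFun_covDeriv (hX.add hX') hY hZ, metricFun_covDeriv hX hY hZ,
    metricFun_covDeriv hX' hY hZ]
  exact (koszul_tensorial_left (hY.diffFieldAt x) (hZ.diffFieldAt x)).add (hX.diffFieldAt x)
    (hX'.diffFieldAt x)

theorem metricFun_covDeriv_smul_left {f : M → ℝ} (hf : ContMDiff 𝓘(ℝ, E) 𝓘(ℝ) ∞ f)
    (hX : IsSmoothField X) (hY : IsSmoothField Y) (hZ : IsSmoothField Z) (x : M) :
    metricFun (covDeriv (f • X) Y) Z x = f x * metricFun (covDeriv X Y) Z x := by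
  rw [metricFun_covDeriv (.smul hf hX) hY hZ, metricFun_covDeriv hX hY hZ]
  exact (koszul_tensorial_left (hY.diffFieldAt x) (hZ.diffFieldAt x)).smul
    ((hf x).mdifferentiableAt (by simp)) (hX.diffFieldAt x)

end LeviCivitaProperties

/-! ### Sasakian manifolds: the contact form, `dΦ = 0`, and `ξ` commuting with `φ`. -/

namespace SasakianStructure
open VectorField

variable {E : Type*} [NormedAddCommGroup E] [NormedSpace ℝ E] [FiniteDimensional ℝ E]
  {M : Type*} [TopologicalSpace M] [ChartedSpace E M] [IsManifold 𝓘(ℝ, E) ∞ M]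
  [RiemannianBundle (fun x : M => TangentSpace 𝓘(ℝ, E) x)]
  [IsContMDiffRiemannianBundle 𝓘(ℝ, E) ∞ E (fun x : M => TangentSpace 𝓘(ℝ, E) x)]
  (S : SasakianStructure E M) {X Y Z : VField E M}

theorem smooth_phiField (hX : IsSmoothField X) : IsSmoothField (S.phiField X) :=
  ContMDiff.clm_bundle_apply (F₁ := E) (F₂ := E) S.smooth_φ hX

theorem η_apply (X : VField E M) : (fun p => S.η p (X p)) = metricFun X S.ξ :=
  funext fun p => S.η_eq p (X p)

/-- Put `φ w` for `w` in the compatibility of the metric: `φ² w = -w + η(w) ξ`, and `ξ` is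
orthogonal to the image of `φ`. -/
theorem inner_φ_left (x : M) (v w : TangentSpace 𝓘(ℝ, E) x) :
    inner ℝ (S.φ x v) w = -inner ℝ v (S.φ x w) := by
  have h := S.metric x v (S.φ x w)
  rw [S.φ_sq, S.η_φ, inner_add_right, inner_neg_right, real_inner_smul_right, ← S.η_eq, S.η_φ] at h
  linarith

theorem metricFun_phi_left (X Y : VField E M) (x : M) :
    metricFun (S.phiField X) Y x = -metricFun X (S.phiField Y) x :=
  S.inner_φ_left x _ _

theorem metricFun_phi_ξ (X : VField E M) (x : M) : metricFun (S.phiField X) S.ξ x = 0 :=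
  (S.η_eq x _).symm.trans (S.η_φ x _)

theorem metricFun_ξ_phi (X : VField E M) (x : M) : metricFun S.ξ (S.phiField X) x = 0 := by
  rw [metricFun_comm, metricFun_phi_ξ]

theorem metricFun_ξ_ξ (x : M) : metricFun S.ξ S.ξ x = 1 :=
  (S.η_eq x _).symm.trans (S.η_ξ x)

theorem metricFun_phi_phi (X Y : VField E M) (x : M) :
    metricFun (S.phiField X) (S.phiField Y) x =
      metricFun X Y x - metricFun X S.ξ x * metricFun Y S.ξ x := by
  have h := S.metric x (X x) (Y x)
  rw [S.η_eq, S.η_eq] at h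
  exact h

theorem metricFun_phi_phi_right (X Y : VField E M) (x : M) :
    metricFun X (S.phiField (S.phiField Y)) x =
      -metricFun X Y x + metricFun X S.ξ x * metricFun Y S.ξ x := by
  have h := S.metricFun_phi_left X (S.phiField Y) x
  rw [metricFun_phi_phi] at h
  linarith

theorem phiField_ξ : S.phiField S.ξ = 0 := funext fun x => S.φ_ξ x

theorem metricFun_phi_ξ_right (X : VField E M) (x : M) :
    metricFun X (S.phiField S.ξ) x = 0 := by
  rw [phiField_ξ]; exact inner_zero_right _

/-- The contact condition. -/
theorem two_mul_metricFun_phi (hX : IsSmoothField X) (hY : IsSmoothField Y) (x : M) :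
    2 * metricFun X (S.phiField Y) x =
      dirDeriv X (metricFun Y S.ξ) x - dirDeriv Y (metricFun X S.ξ) x
        - metricFun (bracket X Y) S.ξ x := by
  have h := S.contact X Y hX hY x
  rw [AlmostContactStructure.dEta, η_apply, η_apply, S.η_eq] at h
  change _ = metricFun X (S.phiField Y) x at h
  rw [← h]
  simp only [metricFun]
  ring

/-- This is `L_ξ η = 0`: `dη(ξ, ·) = 0` because `φ X` is orthogonal to `ξ`, and `η(ξ)` is constant.
-/
theorem dirDeriv_ξ_eta (hX : IsSmoothField X) (x : M) :
    dirDeriv S.ξ (metricFun X S.ξ) x = metricFun (bracket S.ξ X) S.ξ x := by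
  have h := S.two_mul_metricFun_phi S.smooth_ξ hX x
  have h1 : metricFun S.ξ S.ξ = fun _ => 1 := funext S.metricFun_ξ_ξ
  rw [metricFun_ξ_phi, h1, dirDeriv_const] at h
  linarith

/-- The fundamental form is closed. -/
theorem fundamentalForm_closed (hX : IsSmoothField X) (hY : IsSmoothField Y)
    (hZ : IsSmoothField Z) (x : M) :
    dirDeriv X (metricFun Y (S.phiField Z)) x + dirDeriv Y (metricFun Z (S.phiField X)) x
      + dirDeriv Z (metricFun X (S.phiField Y)) x - metricFun (bracket X Y) (S.phiField Z) x
      - metricFun (bracket Y Z) (S.phiField X) x - metricFun (bracket Z X) (S.phiField Y) x = 0 := by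
  -- Since `Φ = dη`, the claim is `d² η = 0`. The contact condition is substituted into the
  -- derivative terms (`key`) and the bracket terms (`bk`); the iterated derivatives of `η` cancel,
  -- and the Jacobi identity disposes of the double brackets.
  have key : ∀ {X Y Z : VField E M}, IsSmoothField X → IsSmoothField Y → IsSmoothField Z →
      2 * dirDeriv X (metricFun Y (S.phiField Z)) x =
        dirDeriv X (dirDeriv Y (metricFun Z S.ξ)) x - dirDeriv X (dirDeriv Z (metricFun Y S.ξ)) x
          - dirDeriv X (metricFun (bracket Y Z) S.ξ) x := by
    intro X Y Z hX hY hZ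
    have mY := mdiff_dirDeriv (contMDiff_metricFun hZ S.smooth_ξ) hY x
    have mZ := mdiff_dirDeriv (contMDiff_metricFun hY S.smooth_ξ) hZ x
    have mb := (hY.bracket hZ).diffFieldAt x |>.metricFun (S.smooth_ξ.diffFieldAt x)
    rw [← dirDeriv_sub X mY mZ, ← dirDeriv_sub X (mY.sub mZ) mb, ← dirDeriv_const_mul]
    · congr 1
      exact funext fun p => S.two_mul_metricFun_phi hY hZ p
    · exact (hY.diffFieldAt x).metricFun ((S.smooth_phiField hZ).diffFieldAt x)
  have bk : ∀ {X Y Z : VField E M}, IsSmoothField X → IsSmoothField Y → IsSmoothField Z →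
      2 * metricFun (bracket X Y) (S.phiField Z) x =
        dirDeriv X (dirDeriv Y (metricFun Z S.ξ)) x - dirDeriv Y (dirDeriv X (metricFun Z S.ξ)) x
          - dirDeriv Z (metricFun (bracket X Y) S.ξ) x
          - metricFun (bracket (bracket X Y) Z) S.ξ x := by
    intro X Y Z hX hY hZ
    rw [S.two_mul_metricFun_phi (hX.bracket hY) hZ,
      dirDeriv_bracket (contMDiff_metricFun hZ S.smooth_ξ) hX hY]
  have jac : metricFun (bracket (bracket X Y) Z) S.ξ x + metricFun (bracket (bracket Y Z) X) S.ξ x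
      + metricFun (bracket (bracket Z X) Y) S.ξ x = 0 := by
    have h := bracket_jacobi hX hY hZ x
    rw [bracket_swap X (bracket Y Z), bracket_swap Y (bracket X Z)] at h
    have h' : bracket X Z = - bracket Z X := funext fun p => bracket_swap X Z p
    have h2 : bracket (-bracket Z X) Y x = -bracket (bracket Z X) Y x := by
      have := mlieBracket_const_smul_left (c := (-1 : ℝ)) (W := Y) ((hZ.bracket hX).diffFieldAt x)
      simpa using! this
    rw [h', h2] at h
    simp only [metricFun]
    rw [← inner_add_left, ← inner_add_left]
    have h0 : bracket (bracket X Y) Z x + bracket (bracket Y Z) X x + bracket (bracket Z X) Y x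
        = 0 := by
      rw [neg_neg] at h
      rw [add_right_comm, ← h]; simp
    rw [h0, inner_zero_left]
  linear_combination (1 / 2) * key hX hY hZ + (1 / 2) * key hY hZ hX + (1 / 2) * key hZ hX hY
    - (1 / 2) * bk hX hY hZ - (1 / 2) * bk hY hZ hX - (1 / 2) * bk hZ hX hY + (1 / 2) * jac

/-- The characteristic vector field commutes with `φ`. -/
theorem bracket_phi_ξ (hX : IsSmoothField X) (x : M) :
    bracket (S.phiField X) S.ξ x = S.φ x (bracket X S.ξ x) := by
  have h := S.normal X S.ξ hX S.smooth_ξ x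
  have hd : S.dEta X S.ξ x = 0 := by
    rw [S.contact X S.ξ hX S.smooth_ξ x, S.φ_ξ, inner_zero_right]
  have hb : ∀ W : VField E M, bracket W (0 : VField E M) x = 0 := fun W =>
    congrFun (mlieBracket_zero_right (I := 𝓘(ℝ, E)) (W := W)) x
  rw [hd, AlmostContactStructure.nijenhuis, phiField_ξ, hb, hb] at h
  simp only [mul_zero, zero_smul, add_zero, map_zero, sub_zero] at h
  rw [← map_sub] at h
  have hη : S.η x (bracket (S.phiField X) S.ξ x) = 0 := by
    have h2 := S.two_mul_metricFun_phi (S.smooth_phiField hX) S.smooth_ξ x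
    have h1 : metricFun S.ξ S.ξ = fun _ => 1 := funext S.metricFun_ξ_ξ
    have h3 : metricFun (S.phiField X) S.ξ = fun _ => 0 := funext (S.metricFun_phi_ξ X)
    rw [metricFun_phi_ξ_right, h1, h3, dirDeriv_const, dirDeriv_const] at h2
    rw [S.η_eq]
    change metricFun _ _ x = 0
    linarith
  -- The difference `w = φ[X, ξ] - [φ X, ξ]` has `φ w = 0`, by normality with second argument `ξ`,
  -- and `η(w) = 0`. Then `φ² w = -w + η(w) ξ` forces `w = 0`.
  have h4 := S.φ_sq x (S.φ x (bracket X S.ξ x) - bracket (S.phiField X) S.ξ x)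
  rw [h, map_zero, map_sub, S.η_φ, hη, sub_zero, zero_smul, add_zero, eq_comm, neg_eq_zero,
    sub_eq_zero] at h4
  exact h4.symm

theorem bracket_ξ_phi (hX : IsSmoothField X) (x : M) :
    bracket S.ξ (S.phiField X) x = S.φ x (bracket S.ξ X x) := by
  rw [bracket_swap, bracket_phi_ξ S hX, bracket_swap S.ξ X, map_neg]

end SasakianStructure

/-! ### Sasakian manifolds: `ξ` is Killing, and the covariant derivative of `φ`. -/

namespace SasakianStructure
open VectorField

variable {E : Type*} [NormedAddCommGroup E] [NormedSpace ℝ E] [FiniteDimensional ℝ E]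
  {M : Type*} [TopologicalSpace M] [ChartedSpace E M] [IsManifold 𝓘(ℝ, E) ∞ M]
  [RiemannianBundle (fun x : M => TangentSpace 𝓘(ℝ, E) x)]
  [IsContMDiffRiemannianBundle 𝓘(ℝ, E) ∞ E (fun x : M => TangentSpace 𝓘(ℝ, E) x)]
  (S : SasakianStructure E M) {X Y Z : VField E M}

theorem phi_phi (Y : VField E M) :
    S.phiField (S.phiField Y) = -Y + metricFun Y S.ξ • S.ξ :=
  funext fun x => by
    have h := S.φ_sq x (Y x)
    rw [S.η_eq] at h
    exact h

/-- `ξ` is a Killing field, on products with `φ Y`. -/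
theorem dirDeriv_ξ_metricFun_phi (hX : IsSmoothField X) (hY : IsSmoothField Y) (x : M) :
    dirDeriv S.ξ (metricFun X (S.phiField Y)) x =
      metricFun (bracket S.ξ X) (S.phiField Y) x + metricFun X (bracket S.ξ (S.phiField Y)) x := by
  -- Cartan's argument: `dΦ = 0` and `Φ(ξ, ·) = 0` give `L_ξ Φ = 0`.
  have h := S.fundamentalForm_closed S.smooth_ξ hX hY x
  have h1 : metricFun Y (S.phiField S.ξ) = fun _ => 0 := funext (S.metricFun_phi_ξ_right Y)
  have h2 : metricFun S.ξ (S.phiField X) = fun _ => 0 := funext (S.metricFun_ξ_phi X)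
  rw [h1, h2, dirDeriv_const, dirDeriv_const, metricFun_phi_ξ_right] at h
  have h3 : metricFun (bracket Y S.ξ) (S.phiField X) x =
      metricFun X (bracket S.ξ (S.phiField Y)) x := by
    simp only [metricFun]
    rw [S.bracket_ξ_phi hY, bracket_swap Y, inner_neg_left, real_inner_comm]
    change -inner ℝ (S.φ x (X x)) _ = _
    rw [S.inner_φ_left, neg_neg]
  linarith

/-- Write `g(X, Y) = η(X) η(Y) - g(X, φ² Y)`. The flow of `ξ` preserves `η` and `φ`, and the second
term is covered by the case of products with `φ Y`. -/
theorem dirDeriv_ξ_metricFun (hX : IsSmoothField X) (hY : IsSmoothField Y) (x : M) :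
    dirDeriv S.ξ (metricFun X Y) x =
      metricFun (bracket S.ξ X) Y x + metricFun X (bracket S.ξ Y) x := by
  have h := S.dirDeriv_ξ_metricFun_phi hX (S.smooth_phiField hY) x
  have e : metricFun X (S.phiField (S.phiField Y)) =
      metricFun X S.ξ * metricFun Y S.ξ - metricFun X Y := by
    funext p
    rw [metricFun_phi_phi_right, Pi.sub_apply, Pi.mul_apply]; ring
  have sX := contMDiff_metricFun hX S.smooth_ξ
  have sY := contMDiff_metricFun hY S.smooth_ξ
  have dX := (hX.diffFieldAt x).metricFun (S.smooth_ξ.diffFieldAt x)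
  have dY := (hY.diffFieldAt x).metricFun (S.smooth_ξ.diffFieldAt x)
  have e2 : metricFun X (bracket S.ξ (S.phiField (S.phiField Y))) x =
      metricFun X (S.phiField (S.phiField (bracket S.ξ Y))) x := by
    simp only [metricFun]
    rw [S.bracket_ξ_phi (S.smooth_phiField hY), S.bracket_ξ_phi hY]
    rfl
  rw [e2, metricFun_phi_phi_right, metricFun_phi_phi_right, e,
    dirDeriv_sub _ (dX.mul dY) ((hX.diffFieldAt x).metricFun (hY.diffFieldAt x)),
    dirDeriv_mul _ dX dY, dirDeriv_ξ_eta S hX, dirDeriv_ξ_eta S hY] at h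
  linear_combination -h

/-- `∇_X ξ = -φ X`. -/
theorem metricFun_covDeriv_ξ (hX : IsSmoothField X) (hY : IsSmoothField Y) (x : M) :
    metricFun (covDeriv X S.ξ) Y x = metricFun X (S.phiField Y) x := by
  -- The Killing equation `k` says that the symmetric part of `∇ξ` is zero; the contact condition
  -- `c` computes the skew part.
  have k := S.dirDeriv_ξ_metricFun hX hY x
  have hξ := S.smooth_ξ
  rw [dirDeriv_metricFun hξ hX hY, metricFun_comm X, metricFun_bracket hξ hX hY,
    metricFun_bracket hξ hY hX] at k
  have c := S.two_mul_metricFun_phi hX hY x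
  rw [dirDeriv_metricFun hX hY hξ, dirDeriv_metricFun hY hX hξ, metricFun_bracket hX hY hξ] at c
  linarith

/-- `g((∇_X φ) Y, Z)`. -/
def nablaPhi (X Y Z : VField E M) (x : M) : ℝ :=
  metricFun (covDeriv X (S.phiField Y)) Z x + metricFun (covDeriv X Y) (S.phiField Z) x

/-- The defect of `(∇_X φ) Y = g(X, Y) ξ - η(Y) X`, paired with `Z`. -/
def nablaPhiDefect (X Y Z : VField E M) (x : M) : ℝ :=
  S.nablaPhi X Y Z x - metricFun X Y x * metricFun Z S.ξ x + metricFun Y S.ξ x * metricFun X Z x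

/-- `φ` is skew and `∇` is metric, so `∇_X φ` is skew; the correction terms are skew in `Y`, `Z` as
well. -/
theorem nablaPhiDefect_swap (hX : IsSmoothField X) (hY : IsSmoothField Y) (hZ : IsSmoothField Z)
    (x : M) : S.nablaPhiDefect X Y Z x = -S.nablaPhiDefect X Z Y x := by
  have h1 := dirDeriv_metricFun hX (S.smooth_phiField hY) hZ x
  have h2 := dirDeriv_metricFun hX hY (S.smooth_phiField hZ) x
  have h3 : metricFun (S.phiField Y) Z = fun p => (-1) * metricFun Y (S.phiField Z) p :=
    funext fun p => by rw [metricFun_phi_left]; ring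
  rw [h3, dirDeriv_const_mul _ _
    ((hY.diffFieldAt x).metricFun ((S.smooth_phiField hZ).diffFieldAt x))] at h1
  simp only [nablaPhiDefect, nablaPhi]
  linear_combination -h1 - h2

/-- `dΦ = 0` with brackets replaced by covariant derivatives; the correction terms cancel in the
cyclic sum. -/
theorem nablaPhiDefect_cyclic (hX : IsSmoothField X) (hY : IsSmoothField Y)
    (hZ : IsSmoothField Z) (x : M) :
    S.nablaPhiDefect X Y Z x + S.nablaPhiDefect Y Z X x + S.nablaPhiDefect Z X Y x = 0 := by
  have h := S.fundamentalForm_closed hX hY hZ x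
  have pX := S.smooth_phiField hX
  have pY := S.smooth_phiField hY
  have pZ := S.smooth_phiField hZ
  rw [dirDeriv_metricFun hX hY pZ, dirDeriv_metricFun hY hZ pX, dirDeriv_metricFun hZ hX pY,
    metricFun_bracket hX hY pZ, metricFun_bracket hY hZ pX, metricFun_bracket hZ hX pY] at h
  rw [nablaPhiDefect_swap S hX hY hZ, nablaPhiDefect_swap S hY hZ hX, nablaPhiDefect_swap S hZ hX hY]
  simp only [nablaPhiDefect, nablaPhi]
  rw [metricFun_comm Z X, metricFun_comm Y X, metricFun_comm Z Y]
  linear_combination -h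

/-- Normality with each bracket replaced by a difference of covariant derivatives. The term `2 dη ⊗
ξ` is exactly what the correction terms in the defect absorb. -/
theorem nablaPhiDefect_nijenhuis (hX : IsSmoothField X) (hY : IsSmoothField Y)
    (hZ : IsSmoothField Z) (x : M) :
    S.nablaPhiDefect (S.phiField X) Y Z x - S.nablaPhiDefect (S.phiField Y) X Z x
      + S.nablaPhiDefect X Y (S.phiField Z) x - S.nablaPhiDefect Y X (S.phiField Z) x = 0 := by
  have pX := S.smooth_phiField hX
  have pY := S.smooth_phiField hY
  have pZ := S.smooth_phiField hZ
  have h : metricFun (S.phiField (S.phiField (bracket X Y))) Z x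
      + metricFun (bracket (S.phiField X) (S.phiField Y)) Z x
      - metricFun (S.phiField (bracket (S.phiField X) Y)) Z x
      - metricFun (S.phiField (bracket X (S.phiField Y))) Z x
      + 2 * metricFun X (S.phiField Y) x * metricFun Z S.ξ x = 0 := by
    have h := congrArg (fun v => inner ℝ v (Z x)) (S.normal X Y hX hY x)
    simp only [AlmostContactStructure.nijenhuis, inner_add_left, inner_sub_left, inner_zero_left,
      real_inner_smul_left, S.contact X Y hX hY x] at h
    rw [metricFun_comm Z]
    exact h
  rw [metricFun_phi_left, metricFun_phi_left, metricFun_phi_left, metricFun_phi_left,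
    metricFun_bracket hX hY (S.smooth_phiField pZ), metricFun_bracket pX pY hZ,
    metricFun_bracket pX hY pZ, metricFun_bracket hX pY pZ] at h
  simp only [nablaPhiDefect, nablaPhi]
  rw [S.metricFun_phi_ξ Z, S.metricFun_phi_left X Y, metricFun_comm (S.phiField Y) X,
    S.metricFun_phi_left X Z, S.metricFun_phi_left Y Z]
  linear_combination h

/-- Write `T(X; Y, Z)` for the defect at `(φ X, Y, Z)`. Normality, the cyclic identity and skewness
combine to `T(X; Y, Z) + T(Y; Z, X) = T(Z; X, Y)`. Adding this to its cyclic permutation starting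
with `Z` leaves `2 T(X; Y, Z) = 0`. -/
theorem nablaPhiDefect_phi (hX : IsSmoothField X) (hY : IsSmoothField Y) (hZ : IsSmoothField Z)
    (x : M) : S.nablaPhiDefect (S.phiField X) Y Z x = 0 := by
  have key : ∀ {X Y Z : VField E M}, IsSmoothField X → IsSmoothField Y → IsSmoothField Z →
      S.nablaPhiDefect (S.phiField X) Y Z x + S.nablaPhiDefect (S.phiField Y) Z X x =
        S.nablaPhiDefect (S.phiField Z) X Y x := by
    intro X Y Z hX hY hZ
    have h1 := S.nablaPhiDefect_nijenhuis hX hY hZ x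
    have h2 := S.nablaPhiDefect_cyclic hX hY (S.smooth_phiField hZ) x
    have h3 := S.nablaPhiDefect_swap hY hX (S.smooth_phiField hZ) x
    have h4 := S.nablaPhiDefect_swap (S.smooth_phiField hY) hX hZ x
    linarith
  have a := key hX hY hZ
  have b := key hZ hX hY
  linarith

/-- Differentiate `g(φ Y, ξ) = 0` along `X` and insert `∇_X ξ = -φ X`. -/
theorem nablaPhiDefect_ξ_right (hX : IsSmoothField X) (hY : IsSmoothField Y) (x : M) :
    S.nablaPhiDefect X Y S.ξ x = 0 := by
  have h := dirDeriv_metricFun hX (S.smooth_phiField hY) S.smooth_ξ x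
  have e : metricFun (S.phiField Y) S.ξ = fun _ => 0 := funext (S.metricFun_phi_ξ Y)
  rw [e, dirDeriv_const, S.metricFun_covDeriv_ξ hX (S.smooth_phiField hY),
    metricFun_phi_phi_right] at h
  simp only [nablaPhiDefect, nablaPhi]
  rw [metricFun_phi_ξ_right, metricFun_ξ_ξ]
  linear_combination -h

theorem nablaPhiDefect_ξ_left (hX : IsSmoothField X) (hY : IsSmoothField Y) (x : M) :
    S.nablaPhiDefect S.ξ X Y x = 0 := by
  have h := S.nablaPhiDefect_cyclic S.smooth_ξ hX hY x
  rw [S.nablaPhiDefect_swap hY S.smooth_ξ hX, S.nablaPhiDefect_ξ_right hX hY,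
    S.nablaPhiDefect_ξ_right hY hX] at h
  linarith

/-- On a Sasakian manifold `(∇_X φ) Y = g(X, Y) ξ - η(Y) X`. -/
theorem nablaPhi_eq (hX : IsSmoothField X) (hY : IsSmoothField Y) (hZ : IsSmoothField Z)
    (x : M) : S.nablaPhi X Y Z x =
      metricFun X Y x * metricFun Z S.ξ x - metricFun Y S.ξ x * metricFun X Z x := by
  suffices h : S.nablaPhiDefect X Y Z x = 0 by
    simp only [nablaPhiDefect] at h
    linarith
  have hf := contMDiff_metricFun hX S.smooth_ξ
  have pX := (S.smooth_phiField hX).neg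
  -- The defect is tensorial in `X`, and `X = -φ² X + η(X) ξ` splits `X` into a part in the image of
  -- `φ` and a multiple of `ξ`; the defect vanishes on both.
  have e : X = S.phiField (-S.phiField X) + metricFun X S.ξ • S.ξ := by
    funext x
    have h := congrFun (S.phi_phi X) x
    have h' : S.phiField (-S.phiField X) x = -S.phiField (S.phiField X) x := map_neg _ _
    rw [Pi.add_apply, h', h]
    simp
  have h1 := S.nablaPhiDefect_phi pX hY hZ x
  have h2 := S.nablaPhiDefect_ξ_left hY hZ x
  simp only [nablaPhiDefect, nablaPhi] at h1 h2
  have hsm := IsSmoothField.smul hf S.smooth_ξ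
  simp only [nablaPhiDefect, nablaPhi]
  have a1 := metricFun_covDeriv_add_left (S.smooth_phiField pX) hsm (S.smooth_phiField hY) hZ x
  have a2 := metricFun_covDeriv_add_left (S.smooth_phiField pX) hsm hY (S.smooth_phiField hZ) x
  have b1 := metricFun_covDeriv_smul_left hf S.smooth_ξ (S.smooth_phiField hY) hZ x
  have b2 := metricFun_covDeriv_smul_left hf S.smooth_ξ hY (S.smooth_phiField hZ) x
  have c1 := congrFun (metricFun_add_left (S.phiField (-S.phiField X)) (metricFun X S.ξ • S.ξ) Y) x
  have c2 := congrFun (metricFun_add_left (S.phiField (-S.phiField X)) (metricFun X S.ξ • S.ξ) Z) x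
  rw [← e, Pi.add_apply, metricFun_smul_left, Pi.mul_apply] at c1 c2
  rw [← e] at a1 a2
  rw [a1, a2, b1, b2, c1, c2]
  linear_combination h1 + metricFun X S.ξ x * h2

end SasakianStructure

/-! ### Integrable distributions and involutivity. -/

section Integrable
open VectorField Topology

variable {E : Type*} [NormedAddCommGroup E] [NormedSpace ℝ E] [FiniteDimensional ℝ E]
  {M : Type*} [TopologicalSpace M] [ChartedSpace E M]
  {G : Type*} [NormedAddCommGroup G] [NormedSpace ℝ G] [FiniteDimensional ℝ G]

/-- The derivatives of a function with values in a subspace have values in that subspace. -/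
theorem mvfderiv_mem_of_eventually_mem {K : Submodule ℝ G} {f : M → G} {x : M}
    (hf : MDifferentiableAt 𝓘(ℝ, E) 𝓘(ℝ, G) f x) (hK : ∀ᶠ p in 𝓝 x, f p ∈ K)
    (v : TangentSpace 𝓘(ℝ, E) x) : mvfderiv 𝓘(ℝ, E) f x v ∈ K := by
  -- Projection along `K` onto a complement gives a linear map `L` with kernel `K`, so that `L ∘ f`
  -- vanishes near `x`.
  obtain ⟨q, hq⟩ := K.exists_isCompl
  set L : G →L[ℝ] q := LinearMap.toContinuousLinearMap (Submodule.projectionOnto q K hq.symm)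
  have hL : ∀ w : G, L w = 0 ↔ w ∈ K := fun w =>
    Submodule.projectionOnto_apply_eq_zero_iff hq.symm
  rw [← hL]
  have h0 : (L ∘ f) =ᶠ[𝓝 x] fun _ => (0 : q) := hK.mono fun p hp => (hL _).2 hp
  have h1 := mfderiv_comp x (L.mdifferentiableAt (x := f x)) hf
  rw [h0.mfderiv_eq, mfderiv_const, mfderiv_eq_fderiv, L.fderiv] at h1
  exact (DFunLike.congr_fun h1 v).symm

/-- Integrable distributions are involutive. -/
theorem IsIntegrable.bracket_mem [IsManifold 𝓘(ℝ, E) ∞ M] {D : TangentDistribution E M}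
    (hD : IsIntegrable D) {X Y : VField E M} (hX : IsSection D X) (hY : IsSection D Y) (x : M) :
    bracket X Y x ∈ D x := by
  obtain ⟨ψ, hψ, hx, K, hK⟩ := hD x
  have hnhds : ψ.source ∈ 𝓝 x := ψ.open_source.mem_nhds hx
  have hs : ContMDiffAt 𝓘(ℝ, E) 𝓘(ℝ, E) 2 ψ x :=
    ((contMDiffOn_of_mem_maximalAtlas hψ).contMDiffAt hnhds).of_le two_le_infty
  -- Treat the flattening chart as an `E`-valued function: `dψ([X, Y]) = X(Y ψ) - Y(X ψ)`, where `Y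
  -- ψ` and `X ψ` take values in `K` near `x`.
  rw [hK x hx, mvfderiv_mlieBracket hs (hX.smooth.diffFieldAt x) (hY.smooth.diffFieldAt x)]
  refine K.sub_mem ?_ ?_
  · refine mvfderiv_mem_of_eventually_mem
      (mdifferentiableAt_mvfderiv_apply hs (hY.smooth.diffFieldAt x)) ?_ _
    filter_upwards [hnhds] with p hp using (hK p hp _).1 (hY.mem p)
  · refine mvfderiv_mem_of_eventually_mem
      (mdifferentiableAt_mvfderiv_apply hs (hX.smooth.diffFieldAt x)) ?_ _
    filter_upwards [hnhds] with p hp using (hK p hp _).1 (hX.mem p)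

/-- Takes the place of Frobenius' theorem in the converse direction. -/
theorem isIntegrable_top [IsManifold 𝓘(ℝ, E) ∞ M] : IsIntegrable (fun _ : M => ⊤ : TangentDistribution E M) :=
  fun x => ⟨chartAt E x, IsManifold.chart_mem_maximalAtlas x, mem_chart_source E x, ⊤,
    fun _ _ _ => by simp⟩

end Integrable

/-! ### Global extension of tangent vectors. -/

section Extension
open Topology

variable {E : Type*} [NormedAddCommGroup E] [NormedSpace ℝ E] [FiniteDimensional ℝ E]
  {M : Type*} [TopologicalSpace M] [T2Space M] [ChartedSpace E M] [IsManifold 𝓘(ℝ, E) ∞ M]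

/-- Every tangent vector extends to a smooth vector field. -/
theorem exists_isSmoothField_eq (x : M) (v : TangentSpace 𝓘(ℝ, E) x) :
    ∃ X : VField E M, IsSmoothField X ∧ X x = v := by
  obtain ⟨s, hs, hsm⟩ := FiberBundle.exists_contMDiffOn_extend (k := ∞) 𝓘(ℝ, E) E v
  obtain ⟨f, -, hf⟩ := ((SmoothBumpFunction.nhds_basis_tsupport (I := 𝓘(ℝ, E)) x).mem_iff.1
    (interior_mem_nhds.2 hs))
  refine ⟨fun p => f p • FiberBundle.extend E v p, ?_, ?_⟩
  · exact ContMDiffOn.smul_section_of_tsupport (f.contMDiff.contMDiffOn) isOpen_interior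
      hf (hsm.mono interior_subset)
  · simp

end Extension

/-! ### Smoothness of a field tested by inner products, through Gram matrices. -/

section Gram
open Topology

variable {E : Type*} [NormedAddCommGroup E] [NormedSpace ℝ E] [FiniteDimensional ℝ E]
  {M : Type*} [TopologicalSpace M] [ChartedSpace E M]

theorem contMDiffAt_det {ι : Type*} [Fintype ι] [DecidableEq ι] {A : M → Matrix ι ι ℝ} {x : M}
    (hA : ∀ i j, ContMDiffAt 𝓘(ℝ, E) 𝓘(ℝ) ∞ (fun p => A p i j) x) :
    ContMDiffAt 𝓘(ℝ, E) 𝓘(ℝ) ∞ (fun p => (A p).det) x := by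
  simp only [Matrix.det_apply']
  refine ContMDiffAt.sum fun σ _ => ?_
  refine contMDiffAt_const.mul ?_
  exact ContMDiffAt.prod fun i _ => hA _ _

/-- Cramer's rule: the entries of the inverse are polynomials in the entries of `A` divided by `det
A`. -/
theorem contMDiffAt_inv_mulVec {ι : Type*} [Fintype ι] [DecidableEq ι] {A : M → Matrix ι ι ℝ}
    {l : M → ι → ℝ} {x : M} (hA : ∀ i j, ContMDiffAt 𝓘(ℝ, E) 𝓘(ℝ) ∞ (fun p => A p i j) x)
    (hl : ∀ i, ContMDiffAt 𝓘(ℝ, E) 𝓘(ℝ) ∞ (fun p => l p i) x) (hx : (A x).det ≠ 0) (i : ι) :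
    ContMDiffAt 𝓘(ℝ, E) 𝓘(ℝ) ∞ (fun p => ((A p)⁻¹.mulVec (l p)) i) x := by
  simp only [Matrix.mulVec, dotProduct, Matrix.inv_def, Ring.inverse_eq_inv', Matrix.smul_apply,
    smul_eq_mul, Matrix.adjugate_apply]
  refine ContMDiffAt.sum fun j _ => ContMDiffAt.mul (ContMDiffAt.mul ?_ ?_) (hl j)
  · exact (contMDiffAt_det hA).inv₀ hx
  · refine contMDiffAt_det fun a b => ?_
    rcases eq_or_ne a j with rfl | h
    · simpa using contMDiffAt_const
    · simpa [Matrix.updateRow_ne h] using hA a b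

variable [IsManifold 𝓘(ℝ, E) ∞ M]
  [RiemannianBundle (fun x : M => TangentSpace 𝓘(ℝ, E) x)]
  [IsContMDiffRiemannianBundle 𝓘(ℝ, E) ∞ E (fun x : M => TangentSpace 𝓘(ℝ, E) x)]

/-- A vector field is smooth if its inner products with smooth vector fields are. -/
theorem isSmoothField_of_metricFun {W : VField E M}
    (h : ∀ (x : M) (Y : VField E M), ContMDiffAt 𝓘(ℝ, E) 𝓘(ℝ, E).tangent ∞
      (fun p => (⟨p, Y p⟩ : TangentBundle 𝓘(ℝ, E) M)) x →
        ContMDiffAt 𝓘(ℝ, E) 𝓘(ℝ) ∞ (metricFun W Y) x) : IsSmoothField W := by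
  intro x
  set t := trivializationAt E (TangentSpace 𝓘(ℝ, E) : M → Type _) x
  have hx : x ∈ t.baseSet := FiberBundle.mem_baseSet_trivializationAt' x
  set b := Module.finBasis ℝ E
  set s := t.localFrame b
  have hs : ∀ i, ContMDiffAt 𝓘(ℝ, E) 𝓘(ℝ, E).tangent ∞
      (fun p => (⟨p, s i p⟩ : TangentBundle 𝓘(ℝ, E) M)) x :=
    fun i => contMDiffAt_localFrame_of_mem ∞ t b i hx
  refine (contMDiffAt_iff_localFrameCoeff (I := 𝓘(ℝ, E)) (e := t) b hx).2 fun i => ?_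
  set A : M → Matrix _ _ ℝ := fun p => Matrix.of fun i j => metricFun (s i) (s j) p
  -- The Gram matrix of a frame is nonsingular: a kernel vector gives a combination of the frame of
  -- length zero.
  have hdet : ∀ p ∈ t.baseSet, (A p).det ≠ 0 := by
    intro p hp h0
    obtain ⟨c, hc, hc0⟩ := Matrix.exists_mulVec_eq_zero_iff.2 h0
    apply hc
    have hz : ∑ j, c j • s j p = 0 := by
      rw [← inner_self_eq_zero (𝕜 := ℝ), sum_inner]
      refine Finset.sum_eq_zero fun i _ => ?_
      rw [real_inner_smul_left, inner_sum]
      have := congrFun hc0 i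
      simp only [Matrix.mulVec, dotProduct, A, Matrix.of_apply, metricFun, Pi.zero_apply] at this
      simp only [real_inner_smul_right]
      rw [← mul_zero (c i), ← this]
      simp only [mul_comm]
    have hz' : ∑ j, c j • t.basisAt b hp j = 0 := by
      simpa [s, hp] using hz
    exact funext fun j => Fintype.linearIndependent_iff.1 (t.basisAt b hp).linearIndependent c hz' j
  have hA : ∀ i j, ContMDiffAt 𝓘(ℝ, E) 𝓘(ℝ) ∞ (metricFun (s i) (s j)) x :=
    fun i j => ContMDiffAt.inner_bundle (hs i) (hs j)
  -- The frame coefficients of `W` are the inverse Gram matrix applied to the products `g(W, s i)`.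
  refine (contMDiffAt_inv_mulVec (A := A) (l := fun p i => metricFun W (s i) p)
    hA (fun j => h x _ (hs j)) (hdet x hx) i).congr_of_eventuallyEq ?_
  filter_upwards [t.open_baseSet.mem_nhds hx] with p hp
  have hW := t.eq_sum_localFrameCoeff_smul (I := 𝓘(ℝ, E)) (s := W) (b := b) hp
  have hl : (fun i => metricFun W (s i) p) = (A p).mulVec (fun j => t.localFrameCoeff 𝓘(ℝ, E) b j p (W p)) := by
    funext i
    simp only [metricFun, Matrix.mulVec, dotProduct, A, Matrix.of_apply]
    conv_lhs => rw [hW, sum_inner]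
    refine Finset.sum_congr rfl fun j _ => ?_
    rw [real_inner_smul_left, mul_comm, real_inner_comm]
  rw [hl, Matrix.mulVec_mulVec, Matrix.nonsing_inv_mul _ (isUnit_iff_ne_zero.2 (hdet p hp)), Matrix.one_mulVec]
  rfl

end Gram

/-! ### Directional derivatives of finite sums. -/

section DirDerivSum

variable {E : Type*} [NormedAddCommGroup E] [NormedSpace ℝ E]
  {M : Type*} [TopologicalSpace M] [ChartedSpace E M]

theorem dirDeriv_sum {ι : Type} (s : Finset ι) {f : ι → M → ℝ} {x : M} (X : VField E M)
    (hf : ∀ i ∈ s, MDifferentiableAt 𝓘(ℝ, E) 𝓘(ℝ) (f i) x) :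
    dirDeriv X (∑ i ∈ s, f i) x = ∑ i ∈ s, dirDeriv X (f i) x := by
  classical
  induction s using Finset.induction_on with
  | empty => simpa using! dirDeriv_const X 0 x
  | insert a s ha ih =>
    have hs : ∀ i ∈ s, MDifferentiableAt 𝓘(ℝ, E) 𝓘(ℝ) (f i) x := fun i hi =>
      hf i (Finset.mem_insert_of_mem hi)
    have hsum : MDifferentiableAt 𝓘(ℝ, E) 𝓘(ℝ) (∑ i ∈ s, f i) x := MDifferentiableAt.sum hs
    rw [Finset.sum_insert ha, Finset.sum_insert ha, dirDeriv_add X (hf a (by simp)) hsum, ih hs]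

end DirDerivSum

/-! ### The pullback metric `F^* g_N` and its invariance along the fibres. -/

section Submersion
open VectorField Topology

variable {E : Type*} [NormedAddCommGroup E] [NormedSpace ℝ E] [FiniteDimensional ℝ E]
  {M : Type*} [TopologicalSpace M] [ChartedSpace E M] [IsManifold 𝓘(ℝ, E) ∞ M]
  {E' : Type*} [NormedAddCommGroup E'] [NormedSpace ℝ E'] [FiniteDimensional ℝ E']
  {N : Type*} [TopologicalSpace N] [ChartedSpace E' N] [IsManifold 𝓘(ℝ, E') ∞ N]

/-- In local coordinates of `N`, the differential of `F : M → N` is given by the differentials of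
the components of `F`. -/
theorem exists_frame_pushforward {F : M → N} (hF : ContMDiff 𝓘(ℝ, E) 𝓘(ℝ, E') ∞ F) (x : M) :
    ∃ (n : ℕ) (u : Fin n → M → ℝ) (e : Fin n → VField E' N),
      (∀ i, ContMDiffAt 𝓘(ℝ, E) 𝓘(ℝ) 2 (u i) x) ∧ (∀ i, DiffFieldAt (e i) (F x)) ∧
      ∀ᶠ p in 𝓝 x, ∀ v : TangentSpace 𝓘(ℝ, E) p,
        pushforward E E' F p v = ∑ i, mvfderiv 𝓘(ℝ, E) (u i) p v • e i (F p) ∧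
        (pushforward E E' F p v = 0 → ∀ i, mvfderiv 𝓘(ℝ, E) (u i) p v = 0) := by
  set t := trivializationAt E' (TangentSpace 𝓘(ℝ, E') : N → Type _) (F x)
  have hx : F x ∈ t.baseSet := FiberBundle.mem_baseSet_trivializationAt' (F x)
  set b := Module.finBasis ℝ E'
  set φ := extChartAt 𝓘(ℝ, E') (F x)
  set c : Fin _ → E' →L[ℝ] ℝ := fun i => LinearMap.toContinuousLinearMap (b.coord i)
  have hbase : t.baseSet = (chartAt E' (F x)).source := rfl
  have hn : F ⁻¹' t.baseSet ∈ 𝓝 x :=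
    hF.continuous.continuousAt.preimage_mem_nhds (t.open_baseSet.mem_nhds hx)
  -- Over the chart domain the trivialization of `TN` is the differential of the chart, so the
  -- coordinate coefficients of `F_* v` are the derivatives of the components of `φ ∘ F`.
  have hd : ∀ p, F p ∈ t.baseSet → ∀ (v : TangentSpace 𝓘(ℝ, E) p) i,
      mvfderiv 𝓘(ℝ, E) (c i ∘ φ ∘ F) p v =
        t.localFrameCoeff 𝓘(ℝ, E') b i (F p) (pushforward E E' F p v) := by
    intro p hp v i
    have h1 : MDifferentiableAt 𝓘(ℝ, E) 𝓘(ℝ, E') F p := (hF p).mdifferentiableAt (by simp)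
    have h2 : MDifferentiableAt 𝓘(ℝ, E') 𝓘(ℝ, E') φ (F p) := mdifferentiableAt_extChartAt hp
    have h3 := mfderiv_comp p ((c i).mdifferentiableAt (x := φ (F p))) (h2.comp p h1)
    rw [mfderiv_comp p h2 h1, mfderiv_eq_fderiv, (c i).fderiv] at h3
    refine (DFunLike.congr_fun h3 v).trans ?_
    have h4 := t.localFrameCoeff_eq_coeff (I := 𝓘(ℝ, E')) (b := b)
      (s := FiberBundle.extend E' (pushforward E E' F p v)) hp (i := i)
    simp only [FiberBundle.extend_apply_self] at h4
    rw [h4]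
    have h5 := TangentBundle.continuousLinearMapAt_trivializationAt (I := 𝓘(ℝ, E')) (x₀ := F x) hp
    have h6 := DFunLike.congr_fun h5 (pushforward E E' F p v)
    rw [Trivialization.continuousLinearMapAt_apply,
      Trivialization.coe_linearMapAt_of_mem _ hp] at h6
    exact congrArg (fun w => b.repr w i) h6.symm
  refine ⟨_, fun i => c i ∘ φ ∘ F, t.localFrame b, fun i => ?_, fun i => ?_, ?_⟩
  · refine ((c i).contMDiff.contMDiffAt).comp x (ContMDiffAt.comp x ?_ ((hF x).of_le two_le_infty))
    exact contMDiffAt_extChartAt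
  · exact (contMDiffAt_localFrame_of_mem 1 t b i hx).mdifferentiableAt one_ne_zero
  · filter_upwards [hn] with p hp v
    refine ⟨?_, fun h0 i => ?_⟩
    · have h := t.eq_sum_localFrameCoeff_smul (I := 𝓘(ℝ, E')) (b := b)
        (s := FiberBundle.extend E' (pushforward E E' F p v)) hp
      rw [FiberBundle.extend_apply_self] at h
      rw [h]
      exact Finset.sum_congr rfl fun i _ => by rw [hd p hp v i]
    · rw [hd p hp v i, h0, map_zero]

variable [RiemannianBundle (fun x : M => TangentSpace 𝓘(ℝ, E) x)]
  [IsContMDiffRiemannianBundle 𝓘(ℝ, E) ∞ E (fun x : M => TangentSpace 𝓘(ℝ, E) x)]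
  [RiemannianBundle (fun y : N => TangentSpace 𝓘(ℝ, E') y)]
  [IsContMDiffRiemannianBundle 𝓘(ℝ, E') ∞ E' (fun y : N => TangentSpace 𝓘(ℝ, E') y)]

variable (E E') in
/-- The pullback `F^* g_N` of the metric of `N`. -/
def pullbackMetric (F : M → N) (X Y : VField E M) (x : M) : ℝ :=
  inner ℝ (pushforward E E' F x (X x)) (pushforward E E' F x (Y x))

theorem contMDiffAt_pullbackMetric {F : M → N} (hF : ContMDiff 𝓘(ℝ, E) 𝓘(ℝ, E') ∞ F)
    {X Y : VField E M} {x : M}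
    (hX : ContMDiffAt 𝓘(ℝ, E) 𝓘(ℝ, E).tangent ∞
      (fun p => (⟨p, X p⟩ : TangentBundle 𝓘(ℝ, E) M)) x)
    (hY : ContMDiffAt 𝓘(ℝ, E) 𝓘(ℝ, E).tangent ∞
      (fun p => (⟨p, Y p⟩ : TangentBundle 𝓘(ℝ, E) M)) x) :
    ContMDiffAt 𝓘(ℝ, E) 𝓘(ℝ) ∞ (pullbackMetric E E' F X Y) x := by
  have hT := hF.contMDiff_tangentMap (m := ∞) (by simp)
  exact ContMDiffAt.inner_bundle (b := F) (hT.contMDiffAt.comp x hX) (hT.contMDiffAt.comp x hY)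

/-- The pullback metric is invariant under vertical vector fields. -/
theorem dirDeriv_pullbackMetric {F : M → N} (hF : ContMDiff 𝓘(ℝ, E) 𝓘(ℝ, E') ∞ F)
    {V X Y : VField E M} (hV : IsSection (vertical E E' F) V) (hX : IsSmoothField X)
    (hY : IsSmoothField Y) (x : M) :
    dirDeriv V (pullbackMetric E E' F X Y) x =
      pullbackMetric E E' F (bracket V X) Y x + pullbackMetric E E' F X (bracket V Y) x := by
  obtain ⟨n, u, e, hu, he, hfr⟩ := exists_frame_pushforward hF x
  -- Locally `F^* g_N = ∑ (h_ij ∘ F) du_i du_j` with `h_ij = g_N(e_i, e_j)`. A vertical `V` kills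
  -- every `u_i` and `h_ij ∘ F`, so it acts only through `V(X u_i) = [V, X] u_i`.
  have hloc : ∀ X Y : VField E M, pullbackMetric E E' F X Y =ᶠ[𝓝 x]
      ∑ i, ∑ j, dirDeriv X (u i) * (dirDeriv Y (u j) * (metricFun (e i) (e j) ∘ F)) := by
    intro X Y
    filter_upwards [hfr] with p hp
    rw [pullbackMetric, (hp _).1, (hp _).1, sum_inner, Finset.sum_apply]
    refine Finset.sum_congr rfl fun i _ => ?_
    rw [inner_sum, Finset.sum_apply]
    refine Finset.sum_congr rfl fun j _ => ?_
    rw [real_inner_smul_left, real_inner_smul_right]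
    rfl
  have hFx : MDifferentiableAt 𝓘(ℝ, E) 𝓘(ℝ, E') F x := (hF x).mdifferentiableAt (by simp)
  have hm : ∀ i j, MDifferentiableAt 𝓘(ℝ, E) 𝓘(ℝ) (metricFun (e i) (e j) ∘ F) x := fun i j =>
    MDifferentiableAt.comp x ((he i).metricFun (he j)) hFx
  have hm0 : ∀ i j, dirDeriv V (metricFun (e i) (e j) ∘ F) x = 0 := by
    intro i j
    have h := mfderiv_comp x ((he i).metricFun (he j)) hFx
    refine (DFunLike.congr_fun h (V x)).trans ?_
    refine (congrArg (mfderiv 𝓘(ℝ, E') 𝓘(ℝ) (metricFun (e i) (e j)) (F x)) (hV.mem x)).trans ?_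
    exact map_zero _
  have hdu : ∀ {X : VField E M}, IsSmoothField X → ∀ i,
      MDifferentiableAt 𝓘(ℝ, E) 𝓘(ℝ) (dirDeriv X (u i)) x := fun hX i =>
    mdifferentiableAt_mvfderiv_apply (hu i) (hX.diffFieldAt x)
  have hddu : ∀ {X : VField E M}, IsSmoothField X → ∀ i,
      dirDeriv V (dirDeriv X (u i)) x = dirDeriv (bracket V X) (u i) x := by
    intro X hX i
    have h := mvfderiv_mlieBracket (hu i) (hV.smooth.diffFieldAt x) (hX.diffFieldAt x)
    have h0 : dirDeriv V (u i) =ᶠ[𝓝 x] fun _ => 0 := by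
      filter_upwards [hfr] with p hp using (hp _).2 (hV.mem p) i
    have h1 : dirDeriv X (dirDeriv V (u i)) x = 0 := by
      rw [dirDeriv, mvfderiv, h0.mfderiv_eq, mfderiv_const]
      rfl
    change dirDeriv (bracket V X) (u i) x = dirDeriv V (dirDeriv X (u i)) x -
      dirDeriv X (dirDeriv V (u i)) x at h
    rw [h, h1, sub_zero]
  have hl : dirDeriv V (pullbackMetric E E' F X Y) x = dirDeriv V
      (∑ i, ∑ j, dirDeriv X (u i) * (dirDeriv Y (u j) * (metricFun (e i) (e j) ∘ F))) x := by
    rw [dirDeriv, mvfderiv, (hloc X Y).mfderiv_eq]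
    rfl
  have hmul : ∀ i j, MDifferentiableAt 𝓘(ℝ, E) 𝓘(ℝ)
      (dirDeriv X (u i) * (dirDeriv Y (u j) * (metricFun (e i) (e j) ∘ F))) x := fun i j =>
    (hdu hX i).mul ((hdu hY j).mul (hm i j))
  rw [hl, dirDeriv_sum _ _ fun i _ => MDifferentiableAt.sum fun j _ => hmul i j,
    (hloc _ Y).self_of_nhds, (hloc X _).self_of_nhds, Finset.sum_apply, Finset.sum_apply,
    ← Finset.sum_add_distrib]
  refine Finset.sum_congr rfl fun i _ => ?_
  rw [dirDeriv_sum _ _ fun j _ => hmul i j, Finset.sum_apply, Finset.sum_apply,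
    ← Finset.sum_add_distrib]
  refine Finset.sum_congr rfl fun j _ => ?_
  rw [dirDeriv_mul _ (hdu hX i) ((hdu hY j).mul (hm i j)), dirDeriv_mul _ (hdu hY j) (hm i j),
    hm0, hddu hX, hddu hY]
  simp only [Pi.mul_apply]
  ring

end Submersion

/-! ### Riemannian submersions: projections, `A`, and the second fundamental form on vertical
fields. -/

section RiemannianSubmersion
open VectorField Topology

variable {E : Type*} [NormedAddCommGroup E] [NormedSpace ℝ E] [FiniteDimensional ℝ E]
  {M : Type*} [TopologicalSpace M] [ChartedSpace E M] [IsManifold 𝓘(ℝ, E) ∞ M]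
  [RiemannianBundle (fun x : M => TangentSpace 𝓘(ℝ, E) x)]
  [IsContMDiffRiemannianBundle 𝓘(ℝ, E) ∞ E (fun x : M => TangentSpace 𝓘(ℝ, E) x)]
  {E' : Type*} [NormedAddCommGroup E'] [NormedSpace ℝ E'] [FiniteDimensional ℝ E']
  {N : Type*} [TopologicalSpace N] [ChartedSpace E' N] [IsManifold 𝓘(ℝ, E') ∞ N]
  [RiemannianBundle (fun y : N => TangentSpace 𝓘(ℝ, E') y)]
  [IsContMDiffRiemannianBundle 𝓘(ℝ, E') ∞ E' (fun y : N => TangentSpace 𝓘(ℝ, E') y)]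
  {F : M → N}

theorem verPart_mem (F : M → N) (X : VField E M) (x : M) :
    verPart E E' F X x ∈ vertical E E' F x :=
  Submodule.starProjection_apply_mem _ _

theorem horPart_mem (F : M → N) (X : VField E M) (x : M) :
    horPart E E' F X x ∈ horizontal E E' F x :=
  Submodule.starProjection_apply_mem _ _

theorem verPart_add_horPart (F : M → N) (X : VField E M) (x : M) :
    verPart E E' F X x + horPart E E' F X x = X x :=
  Submodule.starProjection_add_starProjection_orthogonal (K := vertical E E' F x) (X x)

theorem inner_eq_zero_of_vertical_of_horizontal {x : M} {v w : TangentSpace 𝓘(ℝ, E) x}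
    (hv : v ∈ vertical E E' F x) (hw : w ∈ horizontal E E' F x) : inner ℝ v w = 0 :=
  (Submodule.mem_orthogonal _ _).1 hw v hv

theorem horPart_eq_self {X : VField E M} (hX : ∀ x, X x ∈ horizontal E E' F x) :
    horPart E E' F X = X :=
  funext fun x => Submodule.starProjection_eq_self_iff.2 (hX x)

theorem verPart_eq_self {X : VField E M} (hX : ∀ x, X x ∈ vertical E E' F x) :
    verPart E E' F X = X :=
  funext fun x => Submodule.starProjection_eq_self_iff.2 (hX x)

theorem verPart_eq_zero {X : VField E M} (hX : ∀ x, X x ∈ horizontal E E' F x) :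
    verPart E E' F X = 0 :=
  funext fun x => (Submodule.starProjection_apply_eq_zero_iff _).2 (hX x)

theorem horPart_eq_zero {X : VField E M} (hX : ∀ x, X x ∈ vertical E E' F x) :
    horPart E E' F X = 0 :=
  funext fun x => (Submodule.starProjection_apply_eq_zero_iff _).2
    (Submodule.le_orthogonal_orthogonal _ (hX x))

theorem inner_verPart {x : M} (X : VField E M) {v : TangentSpace 𝓘(ℝ, E) x}
    (hv : v ∈ vertical E E' F x) : inner ℝ (verPart E E' F X x) v = inner ℝ (X x) v := by
  rw [← verPart_add_horPart (E' := E') F X x, inner_add_left,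
    real_inner_comm v (horPart E E' F X x),
    inner_eq_zero_of_vertical_of_horizontal hv (horPart_mem F X x), add_zero]

theorem inner_horPart {x : M} (X : VField E M) {v : TangentSpace 𝓘(ℝ, E) x}
    (hv : v ∈ horizontal E E' F x) : inner ℝ (horPart E E' F X x) v = inner ℝ (X x) v := by
  have h := congrArg (fun w => inner ℝ w v) (verPart_add_horPart (E' := E') F X x)
  simp only [inner_add_left] at h
  rw [← h, inner_eq_zero_of_vertical_of_horizontal (verPart_mem F X x) hv, zero_add]

theorem pushforward_eq_zero {x : M} {v : TangentSpace 𝓘(ℝ, E) x} (hv : v ∈ vertical E E' F x) :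
    pushforward E E' F x v = 0 := hv

theorem pushforward_horPart (F : M → N) (X : VField E M) (x : M) :
    pushforward E E' F x (horPart E E' F X x) = pushforward E E' F x (X x) := by
  conv_rhs => rw [← verPart_add_horPart (E' := E') F X x]
  rw [map_add, pushforward_eq_zero (verPart_mem F X x), zero_add]

namespace IsRiemannianSubmersion
theorem inner_pushforward_of_horizontal (hF : IsRiemannianSubmersion E E' F) {x : M}
    {v w : TangentSpace 𝓘(ℝ, E) x} (hv : v ∈ horizontal E E' F x)
    (hw : w ∈ horizontal E E' F x) :
    inner ℝ (pushforward E E' F x v) (pushforward E E' F x w) = inner ℝ v w := by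
  have h1 := hF.isometry x _ (Submodule.add_mem _ hv hw)
  rw [map_add] at h1
  rw [real_inner_eq_norm_add_mul_self_sub_norm_mul_self_sub_norm_mul_self_div_two,
    real_inner_eq_norm_add_mul_self_sub_norm_mul_self_sub_norm_mul_self_div_two v w, h1,
    hF.isometry x v hv, hF.isometry x w hw]

/-- One horizontal argument suffices: `F_*` kills the vertical part of the other, which is also
orthogonal to `w`. -/
theorem inner_pushforward (hF : IsRiemannianSubmersion E E' F) {x : M} (X : VField E M)
    {w : TangentSpace 𝓘(ℝ, E) x} (hw : w ∈ horizontal E E' F x) :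
    inner ℝ (pushforward E E' F x (X x)) (pushforward E E' F x w) = inner ℝ (X x) w := by
  rw [← pushforward_horPart, hF.inner_pushforward_of_horizontal (horPart_mem F X x) hw,
    inner_horPart X hw]

/-- The isometry condition gives `g(ℋ X, Y) = F^* g_N(Y, X)`, which is smooth because the tangent
map of `F` is; a field is smooth once such products are. -/
theorem smooth_horPart (hF : IsRiemannianSubmersion E E' F) {X : VField E M}
    (hX : IsSmoothField X) : IsSmoothField (horPart E E' F X) := by
  refine isSmoothField_of_metricFun fun x Y hY => ?_
  have h : metricFun (horPart E E' F X) Y = pullbackMetric E E' F Y X := by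
    funext p
    rw [pullbackMetric, ← pushforward_horPart F X, hF.inner_pushforward Y (horPart_mem F X p)]
    exact real_inner_comm _ _
  rw [h]
  exact contMDiffAt_pullbackMetric hF.smooth hY (hX x)

theorem smooth_verPart (hF : IsRiemannianSubmersion E E' F) {X : VField E M}
    (hX : IsSmoothField X) : IsSmoothField (verPart E E' F X) := by
  have h : verPart E E' F X = X - horPart E E' F X :=
    funext fun x => eq_sub_of_add_eq (verPart_add_horPart F X x)
  rw [h]
  exact hX.sub (hF.smooth_horPart hX)

/-- The metric on horizontal vector fields is invariant under vertical vector fields. -/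
theorem dirDeriv_metricFun_of_horizontal (hF : IsRiemannianSubmersion E E' F)
    {V X Y : VField E M} (hV : IsSection (vertical E E' F) V)
    (hX : IsSection (horizontal E E' F) X) (hY : IsSection (horizontal E E' F) Y) (x : M) :
    dirDeriv V (metricFun X Y) x = metricFun (bracket V X) Y x + metricFun X (bracket V Y) x := by
  have h := dirDeriv_pullbackMetric hF.smooth hV hX.smooth hY.smooth x
  have h1 : ∀ {Z W : VField E M}, (∀ x, W x ∈ horizontal E E' F x) →
      pullbackMetric E E' F Z W = metricFun Z W := fun hW =>
    funext fun p => hF.inner_pushforward _ (hW p)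
  have h2 : pullbackMetric E E' F X (bracket V Y) x = metricFun X (bracket V Y) x := by
    rw [metricFun_comm, ← h1 hX.mem]
    exact real_inner_comm _ _
  rwa [h2, h1 hY.mem, h1 hY.mem] at h

end IsRiemannianSubmersion

theorem oneillA_of_horizontal {X Y : VField E M} (hX : ∀ x, X x ∈ horizontal E E' F x)
    (hY : ∀ x, Y x ∈ horizontal E E' F x) :
    oneillA E E' F X Y = verPart E E' F (covDeriv X Y) := by
  funext x
  rw [oneillA, horPart_eq_self hX, horPart_eq_self hY, verPart_eq_zero hY]
  have h : horPart E E' F (fun p => leviCivita (0 : VField E M) p (X p)) x = 0 := by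
    simp only [horPart, leviCivita_zero, map_zero]
  rw [h, add_zero]
  rfl

theorem oneillA_of_vertical {X V : VField E M} (hX : ∀ x, X x ∈ horizontal E E' F x)
    (hV : ∀ x, V x ∈ vertical E E' F x) :
    oneillA E E' F X V = horPart E E' F (covDeriv X V) := by
  funext x
  rw [oneillA, horPart_eq_self hX, horPart_eq_zero hV, verPart_eq_self hV]
  have h : verPart E E' F (fun p => leviCivita (0 : VField E M) p (X p)) x = 0 := by
    simp only [verPart, leviCivita_zero, map_zero]
  rw [h, zero_add]
  rfl

theorem dirDeriv_congr {f g : M → ℝ} {x : M} (X : VField E M) (h : f =ᶠ[𝓝 x] g) :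
    dirDeriv X f x = dirDeriv X g x := by
  change mfderiv 𝓘(ℝ, E) 𝓘(ℝ) f x (X x) = mfderiv 𝓘(ℝ, E) 𝓘(ℝ) g x (X x)
  rw [h.mfderiv_eq]
  rfl

/-- Locality of `∇`, needed because the frame extension of zero in `pullbackConnection` is shown to
vanish only near `F x`. -/
theorem leviCivita_congr {Y Y' : VField E M} {x : M} (h : Y =ᶠ[𝓝 x] Y')
    (v : TangentSpace 𝓘(ℝ, E) x) : leviCivita Y x v = leviCivita Y' x v := by
  have hk : ∀ X Z : VField E M, koszul X Y Z x = koszul X Y' Z x := fun X Z => by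
    have h1 : metricFun Y Z =ᶠ[𝓝 x] metricFun Y' Z := by
      filter_upwards [h] with p hp
      simp only [metricFun, hp]
    have h2 : metricFun X Y =ᶠ[𝓝 x] metricFun X Y' := by
      filter_upwards [h] with p hp
      simp only [metricFun, hp]
    have hb : bracket X Y x = bracket X Y' x := Filter.EventuallyEq.rfl.mlieBracket_vectorField_eq h
    have hb' : bracket Y Z x = bracket Y' Z x :=
      h.mlieBracket_vectorField_eq Filter.EventuallyEq.rfl
    have hY := h.self_of_nhds
    simp only [koszul, dirDeriv_congr X h1, dirDeriv_congr Z h2]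
    simp only [dirDeriv, metricFun, hb, hb', hY]
  simp only [leviCivita, hk]

/-- `(∇F_*)(X, V) = -F_*(∇_X V)` for vertical `V`. -/
theorem secondFundamentalForm_of_vertical {V : VField E M} (X : VField E M)
    (hV : ∀ x, V x ∈ vertical E E' F x) (hc : Continuous F) (x : M) :
    secondFundamentalForm E E' F X V x = -pushforward E E' F x (covDeriv X V x) := by
  have h : pullbackConnection E E' F (fun p => pushforward E E' F p (V p)) x (X x) = 0 := by
    have h0 : (fun p => pushforward E E' F p (V p)) = fun p => 0 := funext hV
    rw [h0, pullbackConnection]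
    set t := trivializationAt E' (fun y : N => TangentSpace 𝓘(ℝ, E') y) (F x) with ht
    have hbase : F x ∈ t.baseSet := mem_baseSet_trivializationAt E' _ _
    have hzero : ∀ {p : M}, F p ∈ t.baseSet →
        (t (⟨F p, (0 : TangentSpace 𝓘(ℝ, E') (F p))⟩ : TangentBundle 𝓘(ℝ, E') N)).2 = 0 :=
      fun hp => congrArg Prod.snd (t.zeroSection ℝ hp)
    have h1 : (fun p : M =>
        (t (⟨F p, (0 : TangentSpace 𝓘(ℝ, E') (F p))⟩ : TangentBundle 𝓘(ℝ, E') N)).2) =ᶠ[𝓝 x]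
          fun _ => 0 := by
      filter_upwards [hc.continuousAt.preimage_mem_nhds (t.open_baseSet.mem_nhds hbase)] with p hp
      exact hzero hp
    have h2 : mvfderiv 𝓘(ℝ, E) (fun p : M =>
        (t (⟨F p, (0 : TangentSpace 𝓘(ℝ, E') (F p))⟩ : TangentBundle 𝓘(ℝ, E') N)).2) x (X x) = 0 := by
      change mfderiv 𝓘(ℝ, E) 𝓘(ℝ, E') _ x (X x) = 0
      rw [h1.mfderiv_eq, mfderiv_const]
      rfl
    have h3 : (fun y : N => t.symm y (0 : E')) =ᶠ[𝓝 (F x)] (0 : VField E' N) := by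
      filter_upwards [t.open_baseSet.mem_nhds hbase] with y hy
      exact (congrFun (t.coe_symmₗ (R := ℝ) hy) 0).symm.trans (map_zero _)
    simp only [h2, hzero hbase, leviCivita_congr h3, leviCivita_zero, add_zero]
    exact h3.self_of_nhds
  rw [secondFundamentalForm, h, zero_sub]
  rfl

end RiemannianSubmersion

/-! ### Anti-invariant submersions with horizontal `ξ`. -/

section AntiInvariant
open VectorField

variable {E : Type*} [NormedAddCommGroup E] [NormedSpace ℝ E] [FiniteDimensional ℝ E]
  {M : Type*} [TopologicalSpace M] [ChartedSpace E M] [IsManifold 𝓘(ℝ, E) ∞ M]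
  [RiemannianBundle (fun x : M => TangentSpace 𝓘(ℝ, E) x)]
  [IsContMDiffRiemannianBundle 𝓘(ℝ, E) ∞ E (fun x : M => TangentSpace 𝓘(ℝ, E) x)]
  {E' : Type*} [NormedAddCommGroup E'] [NormedSpace ℝ E'] [FiniteDimensional ℝ E']
  {N : Type*} [TopologicalSpace N] [ChartedSpace E' N] [IsManifold 𝓘(ℝ, E') ∞ N]
  [RiemannianBundle (fun y : N => TangentSpace 𝓘(ℝ, E') y)]
  [IsContMDiffRiemannianBundle 𝓘(ℝ, E') ∞ E' (fun y : N => TangentSpace 𝓘(ℝ, E') y)]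
  {F : M → N}

namespace SasakianStructure

variable (S : SasakianStructure E M) {X Y V : VField E M}

/-- `∇_X ξ = -φ X`. -/
theorem covDeriv_ξ [T2Space M] (hX : IsSmoothField X) : covDeriv X S.ξ = -S.phiField X := by
  funext x
  refine ext_inner_right ℝ fun w => ?_
  obtain ⟨W, hW, rfl⟩ := exists_isSmoothField_eq x w
  have h1 := S.metricFun_covDeriv_ξ hX hW x
  have h2 := S.metricFun_phi_left X W x
  simp only [metricFun] at h1 h2
  rw [h1, Pi.neg_apply, inner_neg_left, h2, neg_neg]

/-- `A_X ξ = -B X`, the vertical part of `-φ X`. -/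
theorem oneillA_ξ [T2Space M] (hX : IsSection (horizontal E E' F) X)
    (hξ : ∀ x, S.ξ x ∈ horizontal E E' F x) :
    oneillA E E' F X S.ξ = -verPart E E' F (S.phiField X) := by
  rw [oneillA_of_horizontal hX.mem hξ, S.covDeriv_ξ hX.smooth]
  exact funext fun x => map_neg _ _

theorem isSection_oneillA_ξ [T2Space M] (hF : IsRiemannianSubmersion E E' F)
    (hX : IsSection (horizontal E E' F) X) (hξ : ∀ x, S.ξ x ∈ horizontal E E' F x) :
    IsSection (vertical E E' F) (oneillA E E' F X S.ξ) := by
  rw [S.oneillA_ξ hX hξ]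
  exact ⟨(hF.smooth_verPart (S.smooth_phiField hX.smooth)).neg,
    fun x => Submodule.neg_mem _ (verPart_mem F _ x)⟩

theorem isSection_phiField_of_vertical
    (hanti : ∀ x, ∀ v ∈ vertical E E' F x, S.φ x v ∈ horizontal E E' F x)
    (hV : IsSection (vertical E E' F) V) : IsSection (horizontal E E' F) (S.phiField V) :=
  ⟨S.smooth_phiField hV.smooth, fun x => hanti x _ (hV.mem x)⟩

theorem metricFun_ξ_of_vertical (hξ : ∀ x, S.ξ x ∈ horizontal E E' F x)
    (hV : IsSection (vertical E E' F) V) (x : M) : metricFun V S.ξ x = 0 :=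
  inner_eq_zero_of_vertical_of_horizontal (hV.mem x) (hξ x)

theorem φ_φ_of_vertical (hξ : ∀ x, S.ξ x ∈ horizontal E E' F x) {x : M}
    {v : TangentSpace 𝓘(ℝ, E) x} (hv : v ∈ vertical E E' F x) : S.φ x (S.φ x v) = -v := by
  rw [S.φ_sq, S.η_eq, inner_eq_zero_of_vertical_of_horizontal hv (hξ x), zero_smul, add_zero]

/-- The horizontal part of `φ X` is orthogonal to `φ (ker F_*)`, for horizontal `X`. -/
theorem inner_horPart_phi (hanti : ∀ x, ∀ v ∈ vertical E E' F x, S.φ x v ∈ horizontal E E' F x)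
    (hξ : ∀ x, S.ξ x ∈ horizontal E E' F x) (hX : ∀ x, X x ∈ horizontal E E' F x) {x : M}
    {v : TangentSpace 𝓘(ℝ, E) x} (hv : v ∈ vertical E E' F x) :
    inner ℝ (horPart E E' F (S.phiField X) x) (S.φ x v) = 0 := by
  rw [inner_horPart _ (hanti x v hv)]
  change inner ℝ (S.φ x (X x)) (S.φ x v) = 0
  rw [S.inner_φ_left, S.φ_φ_of_vertical hξ hv, inner_neg_right, neg_neg, real_inner_comm,
    inner_eq_zero_of_vertical_of_horizontal hv (hX x)]

/-- `C X` is the horizontal part of `φ X`, for horizontal `X`. -/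
theorem cPart_eq_horPart (hanti : ∀ x, ∀ v ∈ vertical E E' F x, S.φ x v ∈ horizontal E E' F x)
    (hξ : ∀ x, S.ξ x ∈ horizontal E E' F x) (hX : ∀ x, X x ∈ horizontal E E' F x) :
    cPart E' S.toAlmostContactStructure F X = horPart E E' F (S.phiField X) := by
  funext x
  -- The horizontal part of `φ X` lies in `μ`, and the remainder is vertical, hence orthogonal to
  -- `μ`; this characterizes the projection.
  refine (Submodule.eq_starProjection_of_mem_of_inner_eq_zero
    (K := muDist E' S.toAlmostContactStructure F x)
    (Submodule.mem_inf.2 ⟨horPart_mem F _ x, ?_⟩) ?_)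
  · rw [Submodule.mem_orthogonal']
    rintro _ ⟨v, hv, rfl⟩
    exact S.inner_horPart_phi hanti hξ hX hv
  · intro w hw
    have h : S.φ x (X x) - horPart E E' F (S.phiField X) x = verPart E E' F (S.phiField X) x :=
      sub_eq_of_eq_add (verPart_add_horPart F (S.phiField X) x).symm
    rw [h]
    exact inner_eq_zero_of_vertical_of_horizontal (verPart_mem F _ x) hw.1

/-- `g(∇_X Y, V) = -g(A_X A_Y ξ, φ V) - g(C Y, φ A_X V) + η(Y) g(A_X ξ, V)` for horizontal `X`,
`Y` and vertical `V`. -/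
theorem metricFun_covDeriv_of_vertical [T2Space M] (hF : IsRiemannianSubmersion E E' F)
    (hanti : ∀ x, ∀ v ∈ vertical E E' F x, S.φ x v ∈ horizontal E E' F x)
    (hξ : ∀ x, S.ξ x ∈ horizontal E E' F x) (hX : IsSection (horizontal E E' F) X)
    (hY : IsSection (horizontal E E' F) Y) (hV : IsSection (vertical E E' F) V) (x : M) :
    metricFun (covDeriv X Y) V x =
      -inner ℝ (oneillA E E' F X (oneillA E E' F Y S.ξ) x) (S.φ x (V x))
        - inner ℝ (cPart E' S.toAlmostContactStructure F Y x) (S.φ x (oneillA E E' F X V x))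
        + inner ℝ (oneillA E E' F X S.ξ x) (V x) * S.η x (Y x) := by
  have hφV := S.isSection_phiField_of_vertical hanti hV
  have hB := S.isSection_oneillA_ξ hF hY hξ
  have hC : IsSmoothField (horPart E E' F (S.phiField Y)) :=
    hF.smooth_horPart (S.smooth_phiField hY.smooth)
  have hφY := S.smooth_phiField hY.smooth
  rw [S.cPart_eq_horPart hanti hξ hY.mem]
  -- `g(A_X ξ, V) = g(X, φ V)`
  have h1 : inner ℝ (oneillA E E' F X S.ξ x) (V x) = metricFun X (S.phiField V) x := by
    rw [oneillA_of_horizontal hX.mem hξ, inner_verPart _ (hV.mem x)]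
    exact S.metricFun_covDeriv_ξ hX.smooth hV.smooth x
  -- `g(A_X A_Y ξ, φ V) = g(∇_X A_Y ξ, φ V)`
  have h2 : inner ℝ (oneillA E E' F X (oneillA E E' F Y S.ξ) x) (S.φ x (V x)) =
      metricFun (covDeriv X (oneillA E E' F Y S.ξ)) (S.phiField V) x := by
    rw [oneillA_of_vertical hX.mem hB.mem, inner_horPart _ (hanti x _ (hV.mem x))]
    rfl
  -- `g(C Y, φ A_X V) = -g(∇_X V, φ C Y)`
  have h3 : inner ℝ (horPart E E' F (S.phiField Y) x) (S.φ x (oneillA E E' F X V x)) =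
      -metricFun (covDeriv X V) (S.phiField (horPart E E' F (S.phiField Y))) x := by
    rw [oneillA_of_vertical hX.mem hV.mem, ← metricFun_phi_left]
    -- The vertical part of `∇_X V` drops out because `C Y` is orthogonal to `φ (ker F_*)`.
    have h := verPart_add_horPart (E' := E') F (covDeriv X V) x
    change _ = inner ℝ (S.φ x (covDeriv X V x)) _
    rw [← h, map_add, inner_add_left, real_inner_comm _ (S.φ x (verPart E E' F _ x)),
      S.inner_horPart_phi hanti hξ hY.mem (verPart_mem F _ x), zero_add, real_inner_comm]
  -- `g(∇_X C Y, φ V) = -g(∇_X φ V, C Y)`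
  have h4 := dirDeriv_metricFun hX.smooth hC hφV.smooth x
  have h40 : metricFun (horPart E E' F (S.phiField Y)) (S.phiField V) = fun _ => 0 :=
    funext fun p => S.inner_horPart_phi hanti hξ hY.mem (hV.mem p)
  rw [h40, dirDeriv_const] at h4
  -- the two applications of `(∇_X φ) Y = g(X, Y) ξ - η(Y) X`
  have h5 := S.nablaPhi_eq hX.smooth hV.smooth hC x
  have h50 : metricFun X V x = 0 := by
    rw [metricFun_comm]
    exact inner_eq_zero_of_vertical_of_horizontal (hV.mem x) (hX.mem x)
  rw [h50, S.metricFun_ξ_of_vertical hξ hV, nablaPhi] at h5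
  have h6 := S.nablaPhi_eq hX.smooth hY.smooth hφV.smooth x
  rw [nablaPhi, S.metricFun_phi_phi_right, S.metricFun_ξ_of_vertical hξ hV,
    S.metricFun_phi_ξ] at h6
  -- `∇_X φ Y = -∇_X A_Y ξ + ∇_X C Y`
  have h7 : metricFun (covDeriv X (S.phiField Y)) (S.phiField V) x =
      -metricFun (covDeriv X (oneillA E E' F Y S.ξ)) (S.phiField V) x
        + metricFun (covDeriv X (horPart E E' F (S.phiField Y))) (S.phiField V) x := by
    have hsub : ∀ p, S.phiField Y p = horPart E E' F (S.phiField Y) p - oneillA E E' F Y S.ξ p := by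
      intro p
      rw [S.oneillA_ξ hY hξ, Pi.neg_apply, sub_neg_eq_add, add_comm, verPart_add_horPart]
    have e : ∀ W : VField E M, metricFun (S.phiField Y) W =
        metricFun (horPart E E' F (S.phiField Y)) W - metricFun (oneillA E E' F Y S.ξ) W :=
      fun W => funext fun p => by
        rw [Pi.sub_apply, metricFun, hsub, inner_sub_left]
        rfl
    -- Additivity of `∇_X` in the differentiated field, obtained by applying metric compatibility to
    -- the products with `φ V`.
    have d1 := dirDeriv_metricFun hX.smooth hφY hφV.smooth x
    have d2 := dirDeriv_metricFun hX.smooth hB.smooth hφV.smooth x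
    have d3 := dirDeriv_metricFun hX.smooth hC hφV.smooth x
    rw [e, dirDeriv_sub _ ((hC.diffFieldAt x).metricFun (hφV.smooth.diffFieldAt x))
      ((hB.smooth.diffFieldAt x).metricFun (hφV.smooth.diffFieldAt x)), d2, d3,
      metricFun_comm _ (S.phiField Y), e, Pi.sub_apply, metricFun_comm _ (covDeriv X (S.phiField V)),
      metricFun_comm _ (covDeriv X (S.phiField V))] at d1
    linarith
  rw [h1, h2, h3, S.η_eq]
  change _ = _ + _ * metricFun Y S.ξ x
  -- `h6` turns `g(∇_X Y, V)` into `g(∇_X φ Y, φ V)` plus the `η(Y)` term, `h7` splits off `A_Y ξ`,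
  -- and `h4` with `h5` moves the derivative from `C Y` to `V`.
  linear_combination h7 - h6 - h4 - h5

/-- The obstruction to the integrability of the horizontal distribution, in terms of `A`. -/
theorem metricFun_bracket_of_horizontal [T2Space M] (hF : IsRiemannianSubmersion E E' F)
    (hanti : ∀ x, ∀ v ∈ vertical E E' F x, S.φ x v ∈ horizontal E E' F x)
    (hξ : ∀ x, S.ξ x ∈ horizontal E E' F x) (hX : IsSection (horizontal E E' F) X)
    (hY : IsSection (horizontal E E' F) Y) (hV : IsSection (vertical E E' F) V) (x : M) :
    metricFun (bracket X Y) V x =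
      inner ℝ (cPart E' S.toAlmostContactStructure F X x) (S.φ x (oneillA E E' F Y V x))
        - inner ℝ (cPart E' S.toAlmostContactStructure F Y x) (S.φ x (oneillA E E' F X V x))
        + inner ℝ (oneillA E E' F X S.ξ x) (V x) * S.η x (Y x)
        - inner ℝ (oneillA E E' F Y S.ξ x) (V x) * S.η x (X x)
        - inner ℝ (oneillA E E' F X (oneillA E E' F Y S.ξ) x
            - oneillA E E' F Y (oneillA E E' F X S.ξ) x) (S.φ x (V x)) := by
  rw [metricFun_bracket hX.smooth hY.smooth hV.smooth,
    S.metricFun_covDeriv_of_vertical hF hanti hξ hX hY hV,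
    S.metricFun_covDeriv_of_vertical hF hanti hξ hY hX hV, inner_sub_left]
  ring

/-- `g((∇F_*)(X, A_Y ξ), F_* φ V) = -g(A_X A_Y ξ, φ V)`. -/
theorem inner_secondFundamentalForm_oneillA_ξ [T2Space M] (hF : IsRiemannianSubmersion E E' F)
    (hanti : ∀ x, ∀ v ∈ vertical E E' F x, S.φ x v ∈ horizontal E E' F x)
    (hξ : ∀ x, S.ξ x ∈ horizontal E E' F x) (hX : ∀ x, X x ∈ horizontal E E' F x)
    (hY : IsSection (horizontal E E' F) Y) {x : M} {v : TangentSpace 𝓘(ℝ, E) x}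
    (hv : v ∈ vertical E E' F x) :
    inner ℝ (secondFundamentalForm E E' F X (oneillA E E' F Y S.ξ) x)
        (pushforward E E' F x (S.φ x v)) =
      -inner ℝ (oneillA E E' F X (oneillA E E' F Y S.ξ) x) (S.φ x v) := by
  have hB := S.isSection_oneillA_ξ hF hY hξ
  rw [secondFundamentalForm_of_vertical X hB.mem hF.smooth.continuous, inner_neg_left,
    hF.inner_pushforward _ (hanti x v hv), oneillA_of_vertical hX hB.mem,
    inner_horPart _ (hanti x v hv)]

/-- `g([ξ, φ V], V) = -2 g(V, V)`: the brackets of `ξ` with `φ (ker F_*)` are not horizontal. -/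
theorem metricFun_bracket_ξ_phi (hF : IsRiemannianSubmersion E E' F)
    (hanti : ∀ x, ∀ v ∈ vertical E E' F x, S.φ x v ∈ horizontal E E' F x)
    (hξ : ∀ x, S.ξ x ∈ horizontal E E' F x) (hV : IsSection (vertical E E' F) V) (x : M) :
    metricFun (bracket S.ξ (S.phiField V)) V x = -(2 * metricFun V V x) := by
  have hφV := S.isSection_phiField_of_vertical hanti hV
  -- Since `g(ξ, φ V) = 0`, invariance along `V` gives `g([V, ξ], φ V) = -g([V, φ V], ξ)`, and the
  -- contact condition evaluates `g([V, φ V], ξ) = 2 g(V, V)`.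
  have h1 := hF.dirDeriv_metricFun_of_horizontal hV ⟨S.smooth_ξ, hξ⟩ hφV x
  have h2 := S.two_mul_metricFun_phi hV.smooth hφV.smooth x
  have e1 : metricFun S.ξ (S.phiField V) = fun _ => 0 := funext (S.metricFun_ξ_phi V)
  have e2 : metricFun V S.ξ = fun _ => 0 := funext (S.metricFun_ξ_of_vertical hξ hV)
  rw [metricFun_phi_phi_right, metricFun_comm (S.phiField V), e1, e2, dirDeriv_const,
    dirDeriv_const] at h2
  rw [e1, dirDeriv_const, metricFun_comm S.ξ] at h1
  have h3 : metricFun (bracket S.ξ (S.phiField V)) V x =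
      metricFun (bracket V S.ξ) (S.phiField V) x := by
    simp only [metricFun]
    rw [S.bracket_ξ_phi hV.smooth, S.inner_φ_left, bracket_swap V, inner_neg_left]
    rfl
  rw [h3]
  linarith

/-- If the horizontal distribution is involutive, then it is the whole tangent bundle. -/
theorem horizontal_eq_top [T2Space M] (hF : IsRiemannianSubmersion E E' F)
    (hanti : ∀ x, ∀ v ∈ vertical E E' F x, S.φ x v ∈ horizontal E E' F x)
    (hξ : ∀ x, S.ξ x ∈ horizontal E E' F x)
    (h : ∀ X Y V : VField E M, IsSection (horizontal E E' F) X →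
      IsSection (horizontal E E' F) Y → IsSection (vertical E E' F) V →
        ∀ x, metricFun (bracket X Y) V x = 0) :
    horizontal E E' F = fun _ => ⊤ := by
  funext x
  refine (Submodule.orthogonal_eq_top_iff _).2 ((Submodule.eq_bot_iff _).2 fun v hv => ?_)
  obtain ⟨Z, hZ, rfl⟩ := exists_isSmoothField_eq x v
  -- Projecting an arbitrary smooth extension of `v` gives a vertical field through `v`; testing
  -- involutivity on `ξ` and `φ V` yields `g(v, v) = 0`.
  have hV : IsSection (vertical E E' F) (verPart E E' F Z) := ⟨hF.smooth_verPart hZ, verPart_mem F Z⟩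
  have h1 := S.metricFun_bracket_ξ_phi hF hanti hξ hV x
  rw [h _ _ _ ⟨S.smooth_ξ, hξ⟩ (S.isSection_phiField_of_vertical hanti hV) hV] at h1
  have h2 : verPart E E' F Z x = Z x := Submodule.starProjection_eq_self_iff.2 hv
  rw [metricFun, h2] at h1
  exact inner_self_eq_zero (𝕜 := ℝ).1 (by linarith)

end SasakianStructure
end AntiInvariant

/-! ### The equivalence. -/

theorem theorem8
    {E : Type*} [NormedAddCommGroup E] [NormedSpace ℝ E] [FiniteDimensional ℝ E]
    {M : Type*} [TopologicalSpace M] [T2Space M] [SecondCountableTopology M]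
    [ChartedSpace E M] [IsManifold 𝓘(ℝ, E) ∞ M]
    [RiemannianBundle (fun x : M => TangentSpace 𝓘(ℝ, E) x)]
    [IsContMDiffRiemannianBundle 𝓘(ℝ, E) ∞ E (fun x : M => TangentSpace 𝓘(ℝ, E) x)]
    {E' : Type*} [NormedAddCommGroup E'] [NormedSpace ℝ E'] [FiniteDimensional ℝ E']
    {N : Type*} [TopologicalSpace N] [T2Space N] [SecondCountableTopology N]
    [ChartedSpace E' N] [IsManifold 𝓘(ℝ, E') ∞ N]
    [RiemannianBundle (fun y : N => TangentSpace 𝓘(ℝ, E') y)]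
    [IsContMDiffRiemannianBundle 𝓘(ℝ, E') ∞ E' (fun y : N => TangentSpace 𝓘(ℝ, E') y)]
    (S : SasakianStructure E M) (F : M → N)
    (hF : IsRiemannianSubmersion E E' F)
    (hanti : ∀ x, ∀ v ∈ vertical E E' F x, S.φ x v ∈ horizontal E E' F x)
    (hξ : ∀ x, S.ξ x ∈ horizontal E E' F x) :
    List.TFAE
      [IsIntegrable (horizontal E E' F),
       ∀ X Y V : VField E M, IsSection (horizontal E E' F) X → IsSection (horizontal E E' F) Y →
         IsSection (vertical E E' F) V → ∀ x,
         inner ℝ (secondFundamentalForm E E' F Y (oneillA E E' F X S.ξ) x) (pushforward E E' F x (S.φ x (V x)))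
          = inner ℝ (secondFundamentalForm E E' F X (oneillA E E' F Y S.ξ) x) (pushforward E E' F x (S.φ x (V x)))
            + inner ℝ (cPart E' S.toAlmostContactStructure F X x) (S.φ x (oneillA E E' F Y V x))
            - inner ℝ (cPart E' S.toAlmostContactStructure F Y x) (S.φ x (oneillA E E' F X V x))
            + inner ℝ (oneillA E E' F X S.ξ x) (V x) * S.η x (Y x)
            - inner ℝ (oneillA E E' F Y S.ξ x) (V x) * S.η x (X x),
       ∀ X Y V : VField E M, IsSection (horizontal E E' F) X → IsSection (horizontal E E' F) Y →
         IsSection (vertical E E' F) V → ∀ x,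
         inner ℝ (oneillA E E' F X (oneillA E E' F Y S.ξ) x
              - oneillA E E' F Y (oneillA E E' F X S.ξ) x) (S.φ x (V x))
          = inner ℝ (cPart E' S.toAlmostContactStructure F X x) (S.φ x (oneillA E E' F Y V x))
            - inner ℝ (cPart E' S.toAlmostContactStructure F Y x) (S.φ x (oneillA E E' F X V x))
            + inner ℝ (oneillA E E' F X S.ξ x) (V x) * S.η x (Y x)
            - inner ℝ (oneillA E E' F Y S.ξ x) (V x) * S.η x (X x)] := by
  have hbr : ∀ {X Y V : VField E M}, IsSection (horizontal E E' F) X →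
      IsSection (horizontal E E' F) Y → IsSection (vertical E E' F) V → ∀ x, _ :=
    fun hX hY hV => S.metricFun_bracket_of_horizontal hF hanti hξ hX hY hV
  tfae_have 1 → 3 := by
    intro h X Y V hX hY hV x
    have h0 : metricFun (bracket X Y) V x = 0 := by
      rw [metricFun_comm]
      exact inner_eq_zero_of_vertical_of_horizontal (hV.mem x) (h.bracket_mem hX hY x)
    rw [hbr hX hY hV, sub_eq_zero] at h0
    exact h0.symm
  tfae_have 3 → 1 := by
    intro h
    -- By the bracket identity, (iii) is involutivity, which forces `ker F_* = 0`.
    rw [S.horizontal_eq_top hF hanti hξ fun X Y V hX hY hV x => by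
      rw [hbr hX hY hV, h X Y V hX hY hV, sub_self]]
    exact isIntegrable_top
  tfae_have 2 ↔ 3 := by
    refine forall₃_congr fun X Y V => forall₃_congr fun hX hY hV => forall_congr' fun x => ?_
    -- Each second fundamental form term is minus the corresponding `A A ξ` term, so (ii) is a
    -- rearrangement of (iii) at every point.
    rw [S.inner_secondFundamentalForm_oneillA_ξ hF hanti hξ hY.mem hX (hV.mem x),
      S.inner_secondFundamentalForm_oneillA_ξ hF hanti hξ hX.mem hY (hV.mem x), inner_sub_left]
    constructor <;> intro h <;> linarith
  tfae_finish

end
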